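/- **Data model.** Let $L$ be the number of generative models, $p\in(0,1]$ and $\sigma\ge 0$. For $\ell\in[L]$ let $s_\ell\ge 0$ be a (continuous, $1$-periodic) power spectral density (PSD) with $\int_0^1 s_\ell(f)\,df=1$ whose autocorrelation function $r_\ell[m]=\int_0^1 s_\ell(f)e^{\mathrm i2\pi fm}\,df$ satisfies $\sum_{m\in\mathbb Z}|r_\ell[m]|<\infty$. A realization of model $\ell$ is a process $\check X[m]=U[m](X[m]+W[m])$, $m\in\mathbb Z$, where $X$ is a real zero-mean stationary Gaussian process with PSD $s_\ell$, $W$ is zero-mean white Gaussian noise with variance $\sigma^2$, the $U[m]$ are i.i.d. with $\mathrm P[U[m]=1]=1-\mathrm P[U[m]=0]=p$, and $U,X,W$ are mutually independent. The data set consists of $N$ observations $x_1,\dots,x_N$, of which $n_\ell$ belong to model $\ell$ ($N=\sum_\ell n_\ell$); each $x_i=(x_i[0],\dots,x_i[M-1])$, $M\ge1$, is a contiguous length-$M$ segment of a realization of its model. No independence between different observations is assumed: they may come from independent realizations, from (overlapping) segments of the same realization, or be dependent in any other way. **Estimator and distances.** Let $g:\mathbb Z\to\mathbb R$ be even with $g[m]=0$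 for $|m|\ge M$, $g[0]=1$ and $0\le\sum_m g[m]e^{-\mathrm i2\pi fm}\le A<\infty$ for all $f\in[0,1)$. Put $\hat g[m]=g[m]/u[m]$ with $u[0]=p$ and $u[m]=p^2$ for $m\ne0$, and $$\hat s_i(f)=\sum_{|m|<M}\hat g[m]\,\hat r_i[m]\,e^{-\mathrm i2\pi fm},\qquad \hat r_i[m]=\frac1M\sum_{n=0}^{M-|m|-1}x_i[n+|m|]\,x_i[n],$$ $$d(x_i,x_j)=\tfrac12\int_0^1|\hat s_i(f)-\hat s_j(f)|\,df,\qquad d(X^{(k)},X^{(\ell)})=\tfrac12\int_0^1|s_k(f)-s_\ell(f)|\,df .$$ **Nearest neighbor graph.** Given $q$, for every $i\in[N]$ let $\mathcal T_i\subset[N]\setminus\{i\}$ be a set of cardinality $q$ with $d(x_i,x_j)\le d(x_i,x_v)$ for all $j\in\mathcal T_i$ and all $v\notin\mathcal T_i\cup\{i\}$ (ties broken arbitrarily). Let $Z_{ij}=\exp(-2d(x_i,x_j))$ if $i\in\mathcal T_j$ and $Z_{ij}=0$ otherwise. The NNPC graph $G$ is the graph on $[N]$ with adjacency matrix $Z+Z^{\top}$.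 It has the *no false connections property* if every node is connected only to nodes belonging to the same generative model. **Theorem.** Let $B=\max_{\ell}\sup_{f\in[0,1)}s_\ell(f)$ and $\mu_{\max}=\max_\ell\sum_{m\in\mathbb Z}|h[m]|\,|r_\ell[m]|$, where $h[m]=1-g[m](1-|m|/M)$ for $|m|<M$ and $h[m]=1$ otherwise. Assume that $q\le\min_{\ell\in[L]}(n_\ell-1)$ and $$\min_{k\ne\ell}d(X^{(k)},X^{(\ell)})>\frac{8\sqrt2\,A\bigl(B+\sigma^2+\sqrt2(1+p)(1+\sigma^2)\bigr)}{p^2}\sqrt{\frac{\log M}{M}}+2\mu_{\max}.$$ Then, with probability at least $1-6N/M^2$, the graph $G$ has the no false connections property (for every choice of the sets $\mathcal T_i$). -/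

import Mathlib

open MeasureTheory ProbabilityTheory
open scoped NNReal

noncomputable section

/-! Deterministic objects: power spectral densities, autocorrelation functions, windows. -/

/-- The autocorrelation function `r[m] = ∫₀¹ s(f) e^{i 2π f m} df` belonging to the power spectral
density `s`. -/
def acf (s : ℝ → ℝ) (m : ℤ) : ℂ :=
  ∫ f in (0 : ℝ)..1, (s f : ℂ) * Complex.exp (2 * Real.pi * f * m * Complex.I)

/-- `s` is a normalized power spectral density with absolutely summable autocorrelation function.
It is viewed as a 1-periodic function on the real line. Absolute summability makes the density
equal almost everywhere to a continuous periodic function, and it is this version that is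
meant (the supremum of the density depends on the choice). -/
structure IsNormalizedPSD (s : ℝ → ℝ) : Prop where
  continuous : Continuous s
  periodic : Function.Periodic s 1
  nonneg : ∀ f, 0 ≤ s f
  integral_eq_one : ∫ f in (0 : ℝ)..1, s f = 1
  summable_acf : Summable fun m : ℤ => ‖acf s m‖

/-- The distance `½ ∫₀¹ |s(f) - s'(f)| df` of two processes with densities `s` and `s'`. -/
def psdDist (s s' : ℝ → ℝ) : ℝ :=
  (1 / 2) * ∫ f in (0 : ℝ)..1, |s f - s' f|

/-- The largest value `max_ℓ sup_{f ∈ [0,1)} s_ℓ(f)` of the densities (the constant `B`). -/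
def maxPSD {L : ℕ} (s : Fin L → ℝ → ℝ) : ℝ :=
  ⨆ l : Fin L, ⨆ f : Set.Ico (0 : ℝ) 1, s l f

/-- The discrete-time Fourier transform of a real sequence. -/
def dtft (g : ℤ → ℝ) (f : ℝ) : ℂ :=
  ∑' m : ℤ, (g m : ℂ) * Complex.exp (-(2 * Real.pi * f * m * Complex.I))

/-- `g` is an even window supported in `{-M+1, …, M-1}` with `g[0] = 1` whose discrete-time Fourier
transform takes values in `[0, A]` (it is real because `g` is even). -/
structure IsWindow (M : ℕ) (A : ℝ) (g : ℤ → ℝ) : Prop where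
  even : ∀ m, g (-m) = g m
  support : ∀ m : ℤ, (M : ℤ) ≤ |m| → g m = 0
  zero : g 0 = 1
  dtft_nonneg : ∀ f ∈ Set.Ico (0 : ℝ) 1, 0 ≤ (dtft g f).re
  dtft_le : ∀ f ∈ Set.Ico (0 : ℝ) 1, (dtft g f).re ≤ A

/-- `u[0] = p` and `u[m] = p²` for `m ≠ 0`: the autocorrelation of the sampling process. -/
def samplingAcf (p : ℝ) (m : ℤ) : ℝ := if m = 0 then p else p ^ 2

/-- The bias-corrected window `g[m] / u[m]`. -/
def correctedWindow (p : ℝ) (g : ℤ → ℝ) (m : ℤ) : ℝ := g m / samplingAcf p m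

/-- `h[m] = 1 - g[m] (1 - |m|/M)` for `|m| < M`, and `1` otherwise. -/
def momentWeight (M : ℕ) (g : ℤ → ℝ) (m : ℤ) : ℝ :=
  if |m| < (M : ℤ) then 1 - g m * (1 - |(m : ℝ)| / M) else 1

/-- The autocorrelation moment `∑_m |h[m]| |r[m]|`. -/
def acfMoment (M : ℕ) (g : ℤ → ℝ) (s : ℝ → ℝ) : ℝ :=
  ∑' m : ℤ, |momentWeight M g m| * ‖acf s m‖

/-- The maximum autocorrelation moment over all generative models. -/
def maxAcfMoment (M : ℕ) (g : ℤ → ℝ) {L : ℕ} (s : Fin L → ℝ → ℝ) : ℝ :=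
  ⨆ l : Fin L, acfMoment M g (s l)

/-! The statistical data model. -/

/-- `U` is a Bernoulli process: independent entries, equal to `1` with probability `p` and to `0`
with probability `1 - p`. -/
structure IsBernoulliProcess {Ω : Type*} [MeasurableSpace Ω] (P : Measure Ω) (p : ℝ)
    (U : ℤ → Ω → ℝ) : Prop where
  measurable : ∀ m, Measurable (U m)
  indep : iIndepFun U P
  prob_one : ∀ m, P.real {ω | U m ω = 1} = p
  prob_zero : ∀ m, P.real {ω | U m ω = 0} = 1 - p

/-- `X` is a zero-mean stationary Gaussian process with power spectral density `s`: its
covariances are `E[X[m] X[n]] = r[m - n]`. -/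
structure IsStationaryGaussian {Ω : Type*} [MeasurableSpace Ω] (P : Measure Ω) (s : ℝ → ℝ)
    (X : ℤ → Ω → ℝ) : Prop where
  measurable : ∀ m, Measurable (X m)
  gaussian : IsGaussianProcess X P
  mean : ∀ m, ∫ ω, X m ω ∂P = 0
  cov : ∀ m n, ((∫ ω, X m ω * X n ω ∂P : ℝ) : ℂ) = acf s (m - n)

/-- `W` is a zero-mean white Gaussian noise process with variance `σ²`. -/
structure IsWhiteGaussianNoise {Ω : Type*} [MeasurableSpace Ω] (P : Measure Ω) (σ : ℝ≥0)
    (W : ℤ → Ω → ℝ) : Prop where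
  measurable : ∀ m, Measurable (W m)
  indep : iIndepFun W P
  law : ∀ m, P.map (W m) = gaussianReal 0 (σ ^ 2)

/-- `(U, X, W)` is a realization of the generative model with density `s`: sampling process,
signal process and noise process, which are mutually independent as processes. -/
structure IsRealization {Ω : Type*} [MeasurableSpace Ω] (P : Measure Ω) (p : ℝ) (σ : ℝ≥0)
    (s : ℝ → ℝ) (U X W : ℤ → Ω → ℝ) : Prop where
  sampling : IsBernoulliProcess P p U
  signal : IsStationaryGaussian P s X
  noise : IsWhiteGaussianNoise P σ W
  indep : iIndepFun (fun (k : Fin 3) (ω : Ω) (m : ℤ) => (![U, X, W] k) m ω) P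

/-- The length-`M` observation, beginning at time `t`, of the noisy process with missing entries
`U[m] (X[m] + W[m])`. -/
def observation {Ω : Type*} (M : ℕ) (U X W : ℤ → Ω → ℝ) (t : ℤ) (ω : Ω) : Fin M → ℝ :=
  fun n => U (t + n) ω * (X (t + n) ω + W (t + n) ω)

/-! The nearest neighbor graph. -/

/-- The empirical autocorrelation `(1/M) ∑_{n=0}^{M-|m|-1} x[n+|m|] x[n]`. -/
def empiricalAcf {M : ℕ} (x : Fin M → ℝ) (m : ℤ) : ℝ :=
  (1 / M) * ∑ n : Fin (M - m.natAbs),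
    x ⟨n + m.natAbs, by have := n.isLt; omega⟩ * x ⟨n, by have := n.isLt; omega⟩

/-- The Blackman-Tukey estimate `∑_{|m| < M} w[m] r̂[m] e^{-i 2π f m}` with window `w`. -/
def blackmanTukey {M : ℕ} (w : ℤ → ℝ) (x : Fin M → ℝ) (f : ℝ) : ℂ :=
  ∑ m ∈ Finset.Ioo (-(M : ℤ)) M,
    (w m : ℂ) * (empiricalAcf x m : ℂ) * Complex.exp (-(2 * Real.pi * f * m * Complex.I))

/-- The distance `½ ∫₀¹ |ŝ(f) - ŝ'(f)| df` of two observations. -/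
def obsDist {M : ℕ} (w : ℤ → ℝ) (x y : Fin M → ℝ) : ℝ :=
  (1 / 2) * ∫ f in (0 : ℝ)..1, ‖blackmanTukey w x f - blackmanTukey w y f‖

/-- `T` consists of `q` nearest neighbors of node `i`, with respect to the distances `D`. If there
are ties, several sets `T` qualify. -/
structure IsNearestNeighbors {N : ℕ} (D : Fin N → Fin N → ℝ) (q : ℕ) (i : Fin N)
    (T : Finset (Fin N)) : Prop where
  notMem : i ∉ T
  card : T.card = q
  le : ∀ j ∈ T, ∀ v, v ≠ i → v ∉ T → D i j ≤ D i v

/-- The matrix `Z` whose `j`-th column has the entries `exp(-2 D i j)` for `i ∈ T j`,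
and `0` otherwise. -/
def weightMatrix {N : ℕ} (D : Fin N → Fin N → ℝ) (T : Fin N → Finset (Fin N)) :
    Matrix (Fin N) (Fin N) ℝ :=
  Matrix.of fun i j => if i ∈ T j then Real.exp (-2 * D i j) else 0

/-- The adjacency matrix `Z + Zᵀ` of the nearest neighbor graph. -/
def nnAdjacency {N : ℕ} (D : Fin N → Fin N → ℝ) (T : Fin N → Finset (Fin N)) :
    Matrix (Fin N) (Fin N) ℝ :=
  weightMatrix D T + (weightMatrix D T).transpose

/-- The no false connections property of the graph with (weighted) adjacency matrix `Adj`, where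
`label i` is the generative model of node `i`: nodes are connected to nodes of the same model
only. -/
def NoFalseConnections {N L : ℕ} (Adj : Matrix (Fin N) (Fin N) ℝ) (label : Fin N → Fin L) : Prop :=
  ∀ i j, Adj i j ≠ 0 → label i = label j

end

section

/-! Squared norms of Gaussian vectors. -/

/-! Put `b = B + σ²`, `c = 1 + σ²` and `r = √(log M / M)`. For each observation, outside an event of
probability at most `6 / M²`, the estimate lies within `K = A/p² · (5b + 7c) r + μ_max` of `s_ℓ +
σ²` in `L¹[0,1]`. The constant `σ²` cancels in differences and the factor `½` absorbs the two
triangle inequalities. So distances within a model are at most `K`, distances between models are at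
least the model distance minus `K`, and the clustering condition makes the latter larger. The union
over observations uses subadditivity only, hence no independence between them.

The `L¹` error splits in two (`integral_norm_blackmanTukey_sub_le`). The bias has Fourier
coefficients `-h[m] r[m]`, so it is uniformly at most the autocorrelation moment (`norm_bias_le`).
The random part is a trigonometric polynomial: by Cauchy–Schwarz and Parseval, a uniform lag error
`δ` costs at most `Aδ/p²` (`integral_norm_window_error_le`).

A single lag deviates by more than `(5b + 7c) r` with probability at most `6 / M³`
(`measure_abs_lag_ge_le`), and there are `M` lags. With `Y = X + W` and `C` its autocovariance, the
centred lag sum is `∑ UU'(YY' - C)` plus `C ∑ (UU' - u)`. For the first sum, conditioning on `U`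
leaves a Gaussian quadratic form. Polarization turns it into two squared norms, and diagonalizing
their covariances gives independent squares, to which a Chernoff bound applies. The second sum is
split into two families of independent bounded products. -/

lemma inv_one_sub_le_exp {x : ℝ} (hx : |x| ≤ 1 / 3) : (1 - x)⁻¹ ≤ Real.exp (x + x ^ 2) := by
  have h := Real.abs_log_sub_add_sum_range_le (x := x) (by linarith) 2
  have hpos : 0 < 1 - x := by linarith [(abs_le.1 hx).2]
  -- The Taylor remainder of `log (1 - x)` after two terms; `|x| / (1 - |x|) ≤ 1/2` exactly when
  -- `|x| ≤ 1/3`.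
  have hb : |x| ^ 3 / (1 - |x|) ≤ x ^ 2 / 2 := by
    rw [div_le_iff₀ (by linarith), ← sq_abs x]
    nlinarith [sq_nonneg |x|, abs_nonneg x]
  norm_num [Finset.sum_range_succ] at h
  have h2 := (abs_le.1 (h.trans hb)).1
  rw [← Real.exp_log (inv_pos.2 hpos), Real.log_inv]
  exact Real.exp_le_exp.2 (by linarith)

lemma exp_neg_mul_sqrt_inv_le {x : ℝ} (hx : |x| ≤ 1 / 3) :
    Real.exp (-(x / 2)) * √((1 - x)⁻¹) ≤ Real.exp (x ^ 2 / 2) := by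
  calc Real.exp (-(x / 2)) * √((1 - x)⁻¹)
      ≤ Real.exp (-(x / 2)) * √(Real.exp (x + x ^ 2)) := by
        gcongr; exact inv_one_sub_le_exp hx
    _ = Real.exp (x ^ 2 / 2) := by
        rw [Real.sqrt_eq_rpow, ← Real.exp_mul, ← Real.exp_add]; congr 1; ring

/-- The integral equals `exp (-x/2) (1 - x)^(-1/2)` with `x = 2θv`, and `1/6` is what keeps `|x| ≤
1/3`. A Dirac mass has no density, so `v = 0` is separate. -/
lemma integral_exp_mul_sq_sub_gaussianReal_le {v : ℝ≥0} {θ : ℝ} (hθ : |θ| * v ≤ 1 / 6) :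
    Integrable (fun x : ℝ => Real.exp (θ * (x ^ 2 - v))) (gaussianReal 0 v) ∧
      ∫ x, Real.exp (θ * (x ^ 2 - v)) ∂(gaussianReal 0 v) ≤ Real.exp (2 * θ ^ 2 * v ^ 2) := by
  rcases eq_or_ne v 0 with rfl | hv
  · rw [gaussianReal_zero_var]
    exact ⟨integrable_dirac (by simp), by simp⟩
  have hv0 : (0 : ℝ) < v := by positivity
  have hx : |2 * θ * v| ≤ 1 / 3 := by
    rw [abs_mul, abs_mul, abs_of_pos hv0]; norm_num; linarith
  have hx1 : 0 < 1 - 2 * θ * v := by linarith [(abs_le.1 hx).2]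
  have hb : 0 < 1 / (2 * v) - θ := by
    have : 1 / (2 * (v : ℝ)) - θ = (1 - 2 * θ * v) / (2 * v) := by field_simp
    rw [this]; positivity
  have hpdf : ∀ x : ℝ, gaussianPDFReal 0 v x * Real.exp (θ * (x ^ 2 - v)) =
      ((√(2 * Real.pi * v))⁻¹ * Real.exp (-(θ * v))) *
        Real.exp (-(1 / (2 * v) - θ) * x ^ 2) := by
    intro x
    rw [gaussianPDFReal, mul_assoc _ (Real.exp _), mul_assoc _ (Real.exp _), ← Real.exp_add,
      ← Real.exp_add]
    congr 2; field_simp; ring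
  have hint : ∫ x, Real.exp (θ * (x ^ 2 - v)) ∂(gaussianReal 0 v) =
      Real.exp (-(2 * θ * v / 2)) * √((1 - 2 * θ * v)⁻¹) := by
    rw [integral_gaussianReal_eq_integral_smul hv]
    simp_rw [smul_eq_mul, hpdf]
    rw [integral_const_mul, integral_gaussian, mul_comm _ (Real.exp _), mul_assoc,
      ← Real.sqrt_inv, ← Real.sqrt_mul (by positivity)]
    congr 2
    · ring
    · have := Real.pi_pos
      field_simp
  refine ⟨?_, ?_⟩
  · rw [gaussianReal_of_var_ne_zero _ hv, integrable_withDensity_iff_integrable_smul'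
      (measurable_gaussianPDF _ _) (ae_of_all _ fun _ => gaussianPDF_lt_top)]
    simp_rw [toReal_gaussianPDF, smul_eq_mul, hpdf]
    exact (integrable_exp_neg_mul_sq hb).const_mul _
  · rw [hint]
    refine (exp_neg_mul_sqrt_inv_le hx).trans (Real.exp_le_exp.2 (le_of_eq (by ring)))

variable {Ω : Type*} [MeasurableSpace Ω] {P : Measure Ω}

lemma mgf_sq_sub_le {w : Ω → ℝ} (hw : HasGaussianLaw w P) (hm : ∫ ω, w ω ∂P = 0)
    {θ : ℝ} (hθ : |θ| * ∫ ω, w ω ^ 2 ∂P ≤ 1 / 6) :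
    Integrable (fun ω => Real.exp (θ * (w ω ^ 2 - ∫ ω, w ω ^ 2 ∂P))) P ∧
      mgf (fun ω => w ω ^ 2 - ∫ ω, w ω ^ 2 ∂P) P θ ≤
        Real.exp (2 * θ ^ 2 * (∫ ω, w ω ^ 2 ∂P) ^ 2) := by
  have hmeas := hw.aemeasurable
  have hvar : Var[w; P] = ∫ ω, w ω ^ 2 ∂P := variance_of_integral_eq_zero hmeas hm
  have hnn : 0 ≤ ∫ ω, w ω ^ 2 ∂P := integral_nonneg fun _ => sq_nonneg _
  have hlaw : P.map w = gaussianReal 0 (∫ ω, w ω ^ 2 ∂P).toNNReal := by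
    rw [hw.map_eq_gaussianReal, hvar, hm]
  have hcoe := Real.coe_toNNReal _ hnn
  have key := integral_exp_mul_sq_sub_gaussianReal_le
    (v := (∫ ω, w ω ^ 2 ∂P).toNNReal) (θ := θ) (by rwa [hcoe])
  rw [hcoe, ← hlaw] at key
  have hc : Continuous fun x : ℝ => Real.exp (θ * (x ^ 2 - ∫ ω, w ω ^ 2 ∂P)) := by fun_prop
  rw [integrable_map_measure hc.aestronglyMeasurable hmeas,
    integral_map hmeas hc.aestronglyMeasurable] at key
  exact key

/-- The centred squared norm of a centred Gaussian vector whose covariance form is bounded by `β`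
and whose covariance trace is at most `T` has a moment generating function bounded by
`exp (2 θ² β T)`. -/
theorem mgf_sum_sq_sub_le {ι : Type*} [Fintype ι] {V : ι → Ω → ℝ}
    (hV : HasGaussianLaw (fun ω i => V i ω) P) (hVm : ∀ i, Measurable (V i))
    (hm : ∀ i, ∫ ω, V i ω ∂P = 0) {β T θ : ℝ}
    (hβ : ∀ a : ι → ℝ, ∫ ω, (∑ i, a i * V i ω) ^ 2 ∂P ≤ β * ∑ i, a i ^ 2)
    (hT : ∑ i, ∫ ω, V i ω ^ 2 ∂P ≤ T) (hβ0 : 0 ≤ β) (hθ : |θ| * β ≤ 1 / 6) :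
    Integrable (fun ω => Real.exp (θ * (∑ i, V i ω ^ 2 - ∑ i, ∫ ω, V i ω ^ 2 ∂P))) P ∧
      mgf (fun ω => ∑ i, V i ω ^ 2 - ∑ i, ∫ ω, V i ω ^ 2 ∂P) P θ ≤
        Real.exp (2 * θ ^ 2 * (β * T)) := by
  classical
  have := hV.isProbabilityMeasure
  have hV2 : ∀ i, MemLp (V i) 2 P := fun i => (hV.eval i).memLp_two
  have hVV : ∀ i j, Integrable (fun ω => V i ω * V j ω) P := fun i j =>
    (hV2 i).integrable_mul (hV2 j)
  let S : Matrix ι ι ℝ := Matrix.of fun i j => ∫ ω, V i ω * V j ω ∂P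
  have hS : S.IsHermitian := by
    ext i j; simp [S, mul_comm]
  -- In an eigenbasis of the covariance matrix the coordinates `w k` are jointly Gaussian and
  -- uncorrelated, hence independent, while the squared norm is unchanged.
  let e := hS.eigenvectorBasis
  let w : ι → Ω → ℝ := fun k ω => ∑ i, e k i * V i ω
  have hwlin : ∀ k, w k = fun ω => ∑ i, e k i * V i ω := fun _ => rfl
  have hw : HasGaussianLaw (fun ω k => w k ω) P := by
    let Lm : (ι → ℝ) →L[ℝ] (ι → ℝ) := LinearMap.toContinuousLinearMap
      (Matrix.toLin' (Matrix.of fun k i => e k i))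
    have h : (fun ω k => w k ω) = fun ω => Lm fun i => V i ω := by
      ext ω k
      simp [w, Lm, Matrix.mulVec, dotProduct]
    rw [h]
    exact hV.map_fun Lm
  have hwmeas : ∀ k, Measurable (w k) := fun k =>
    Finset.measurable_sum _ fun i _ => (hVm i).const_mul _
  have hwm : ∀ k, ∫ ω, w k ω ∂P = 0 := by
    intro k
    rw [hwlin, integral_finsetSum _ fun i _ => ((hV2 i).integrable one_le_two).const_mul _]
    simp [integral_const_mul, hm]
  have hw2 : ∀ k, MemLp (w k) 2 P := fun k => (hw.eval k).memLp_two
  have hwcov : ∀ k l, ∫ ω, w k ω * w l ω ∂P = hS.eigenvalues l * ∑ i, e k i * e l i := by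
    intro k l
    have h1 : ∀ ω, w k ω * w l ω = ∑ i, ∑ j, e k i * e l j * (V i ω * V j ω) := by
      intro ω
      simp only [w, Finset.sum_mul_sum]
      refine Finset.sum_congr rfl fun i _ => Finset.sum_congr rfl fun j _ => by ring
    simp_rw [h1]
    rw [integral_finsetSum _ fun i _ => integrable_finsetSum _ fun j _ => (hVV i j).const_mul _]
    have h2 := hS.mulVec_eigenvectorBasis l
    rw [Finset.mul_sum]
    refine Finset.sum_congr rfl fun i _ => ?_
    rw [integral_finsetSum _ fun j _ => (hVV i j).const_mul _]
    have h3 := congrFun h2 i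
    simp only [Matrix.mulVec, dotProduct, Pi.smul_apply, smul_eq_mul, S, Matrix.of_apply] at h3
    calc ∑ j, ∫ ω, e k i * e l j * (V i ω * V j ω) ∂P
        = e k i * ∑ j, (∫ ω, V i ω * V j ω ∂P) * e l j := by
          rw [Finset.mul_sum]
          refine Finset.sum_congr rfl fun j _ => ?_
          rw [integral_const_mul]; ring
      _ = _ := by rw [h3]; simp only [e]; ring
  have hinner : ∀ k l, ∑ i, e k i * e l i = if k = l then 1 else 0 := by
    intro k l
    have := orthonormal_iff_ite.1 e.orthonormal k l
    rw [← this, PiLp.inner_apply]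
    simp [mul_comm]
  have hindep : iIndepFun w P := by
    refine hw.iIndepFun_of_covariance_eq_zero fun k l hkl => ?_
    rw [covariance_eq_sub (hw2 k) (hw2 l)]
    simp only [Pi.mul_apply, hwm, hwcov, hinner, if_neg hkl]
    simp
  have hwsq : ∀ ω, ∑ k, w k ω ^ 2 = ∑ i, V i ω ^ 2 := by
    intro ω
    have h := e.sum_sq_norm_inner_right (WithLp.toLp 2 fun i => V i ω)
    rw [EuclideanSpace.norm_sq_eq] at h
    simp only [PiLp.inner_apply, Real.norm_eq_abs, sq_abs] at h
    rw [← h]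
    refine Finset.sum_congr rfl fun k _ => ?_
    simp [w, mul_comm]
  have hwsq_int : ∑ k, ∫ ω, w k ω ^ 2 ∂P = ∑ i, ∫ ω, V i ω ^ 2 ∂P := by
    rw [← integral_finsetSum _ fun k _ => (hw2 k).integrable_sq,
      ← integral_finsetSum _ fun k _ => (hV2 k).integrable_sq]
    exact integral_congr_ae (ae_of_all _ hwsq)
  have hwβ : ∀ k, ∫ ω, w k ω ^ 2 ∂P ≤ β := by
    intro k
    refine (hβ fun i => e k i).trans (le_of_eq ?_)
    have := hinner k k
    simp only [if_true] at this
    simp [pow_two, this]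
  have hw0 : ∀ k, 0 ≤ ∫ ω, w k ω ^ 2 ∂P := fun k => integral_nonneg fun _ => sq_nonneg _
  have hone : ∀ k, _ := fun k => mgf_sq_sub_le (hw.eval k) (hwm k) (θ := θ)
    ((mul_le_mul_of_nonneg_left (hwβ k) (abs_nonneg θ)).trans hθ)
  let Y : ι → Ω → ℝ := fun k ω => w k ω ^ 2 - ∫ ω, w k ω ^ 2 ∂P
  have hYm : ∀ k, Measurable (Y k) := fun k => ((hwmeas k).pow_const 2).sub_const _
  have hYi : iIndepFun Y P :=
    hindep.comp (fun k x => x ^ 2 - ∫ ω, w k ω ^ 2 ∂P) fun k => by fun_prop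
  have hsum : (fun ω => ∑ i, V i ω ^ 2 - ∑ i, ∫ ω, V i ω ^ 2 ∂P) = ∑ k, Y k := by
    ext ω
    simp only [Finset.sum_apply, Y, Finset.sum_sub_distrib, hwsq, hwsq_int]
  refine ⟨?_, ?_⟩
  · have := hYi.integrable_exp_mul_sum hYm (s := Finset.univ) (t := θ) fun k _ => (hone k).1
    rw [← hsum] at this
    exact this
  · rw [hsum, hYi.mgf_sum hYm]
    calc ∏ k, mgf (Y k) P θ ≤ ∏ k, Real.exp (2 * θ ^ 2 * (∫ ω, w k ω ^ 2 ∂P) ^ 2) :=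
          Finset.prod_le_prod (fun _ _ => mgf_nonneg) fun k _ => (hone k).2
      _ = Real.exp (∑ k, 2 * θ ^ 2 * (∫ ω, w k ω ^ 2 ∂P) ^ 2) := (Real.exp_sum _ _).symm
      _ ≤ _ := by
          refine Real.exp_le_exp.2 ?_
          rw [← Finset.mul_sum]
          refine mul_le_mul_of_nonneg_left ?_ (by positivity)
          -- The variances of the `w k` are the eigenvalues `λ`: each is at most `β` and their sum
          -- is the trace, so `∑ λ² ≤ β ∑ λ ≤ β T`.
          calc ∑ k, (∫ ω, w k ω ^ 2 ∂P) ^ 2 ≤ ∑ k, β * ∫ ω, w k ω ^ 2 ∂P :=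
                Finset.sum_le_sum fun k _ => by
                  rw [pow_two]; exact mul_le_mul_of_nonneg_right (hwβ k) (hw0 k)
            _ = β * ∑ i, ∫ ω, V i ω ^ 2 ∂P := by rw [← Finset.mul_sum, hwsq_int]
            _ ≤ β * T := mul_le_mul_of_nonneg_left hT hβ0

/-- Chernoff's bound at `θ` and at `-θ`. The parameter stays free, to be fitted to the deviation
later. -/
theorem measure_abs_sum_sq_sub_ge_le {ι : Type*} [Fintype ι] {V : ι → Ω → ℝ}
    (hV : HasGaussianLaw (fun ω i => V i ω) P) (hVm : ∀ i, Measurable (V i))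
    (hm : ∀ i, ∫ ω, V i ω ∂P = 0) {β T θ τ : ℝ}
    (hβ : ∀ a : ι → ℝ, ∫ ω, (∑ i, a i * V i ω) ^ 2 ∂P ≤ β * ∑ i, a i ^ 2)
    (hT : ∑ i, ∫ ω, V i ω ^ 2 ∂P ≤ T) (hβ0 : 0 ≤ β) (hθ0 : 0 ≤ θ) (hθ : θ * β ≤ 1 / 6) :
    P.real {ω | τ ≤ |∑ i, V i ω ^ 2 - ∑ i, ∫ ω, V i ω ^ 2 ∂P|} ≤
      2 * Real.exp (2 * θ ^ 2 * (β * T) - θ * τ) := by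
  have := hV.isProbabilityMeasure
  obtain ⟨hi1, hb1⟩ := mgf_sum_sq_sub_le hV hVm hm hβ hT hβ0 (θ := θ) (by rwa [abs_of_nonneg hθ0])
  obtain ⟨hi2, hb2⟩ := mgf_sum_sq_sub_le hV hVm hm hβ hT hβ0 (θ := -θ)
    (by rwa [abs_neg, abs_of_nonneg hθ0])
  have h1 := measure_ge_le_exp_mul_mgf τ hθ0 hi1
  have h2 := measure_le_le_exp_mul_mgf (-τ) (neg_nonpos.2 hθ0) hi2
  have h1' := h1.trans (mul_le_mul_of_nonneg_left hb1 (Real.exp_pos _).le)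
  have h2' := h2.trans (mul_le_mul_of_nonneg_left hb2 (Real.exp_pos _).le)
  rw [← Real.exp_add] at h1' h2'
  have hsub : {ω | τ ≤ |∑ i, V i ω ^ 2 - ∑ i, ∫ ω, V i ω ^ 2 ∂P|} ⊆
      {ω | τ ≤ ∑ i, V i ω ^ 2 - ∑ i, ∫ ω, V i ω ^ 2 ∂P} ∪
        {ω | ∑ i, V i ω ^ 2 - ∑ i, ∫ ω, V i ω ^ 2 ∂P ≤ -τ} := by
    intro ω hω
    rcases le_abs.1 (show τ ≤ |_| from hω) with h | h
    · exact Or.inl h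
    · exact Or.inr (le_neg.1 h)
  refine (measureReal_mono hsub).trans ((measureReal_union_le _ _).trans ?_)
  refine (add_le_add h1' h2').trans (le_of_eq ?_)
  rw [two_mul]
  ring_nf

/-! Concentration of lagged products of a Bernoulli process. -/

lemma ProbabilityTheory.HasSubgaussianMGF.mono_param {X : Ω → ℝ} {c d : ℝ≥0}
    (h : HasSubgaussianMGF X c P) (hcd : c ≤ d) : HasSubgaussianMGF X d P where
  integrable_exp_mul := h.integrable_exp_mul
  mgf_le t := (h.mgf_le t).trans (by gcongr)

namespace IsBernoulliProcess

variable {p : ℝ} {U : ℤ → Ω → ℝ}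

/-- The two prescribed point masses already add up to one. -/
lemma ae_eq_zero_or_one [IsProbabilityMeasure P] (hU : IsBernoulliProcess P p U) (m : ℤ) :
    ∀ᵐ ω ∂P, U m ω = 0 ∨ U m ω = 1 := by
  have h0 : MeasurableSet {ω | U m ω = 0} := hU.measurable m (measurableSet_singleton 0)
  have h1 : MeasurableSet {ω | U m ω = 1} := hU.measurable m (measurableSet_singleton 1)
  have hd : Disjoint {ω | U m ω = 0} {ω | U m ω = 1} := by
    rw [Set.disjoint_left]
    intro ω (h : U m ω = 0) (h' : U m ω = 1)
    simp [h] at h'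
  have hu : P.real ({ω | U m ω = 0} ∪ {ω | U m ω = 1}) = 1 := by
    rw [measureReal_union hd h1, hU.prob_one, hU.prob_zero]; ring
  have hc : P.real ({ω | U m ω = 0} ∪ {ω | U m ω = 1})ᶜ = 0 := by
    rw [probReal_compl_eq_one_sub (h0.union h1), hu, sub_self]
  rw [measureReal_eq_zero_iff] at hc
  exact hc

lemma integral_eq [IsProbabilityMeasure P] (hU : IsBernoulliProcess P p U) (m : ℤ) :
    ∫ ω, U m ω ∂P = p := by
  have h1 : MeasurableSet {ω | U m ω = 1} := hU.measurable m (measurableSet_singleton 1)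
  have h : U m =ᵐ[P] {ω | U m ω = 1}.indicator 1 := by
    filter_upwards [hU.ae_eq_zero_or_one m] with ω hω
    rcases hω with hω | hω <;> simp [Set.indicator, hω]
  rw [integral_congr_ae h, integral_indicator_one h1, hU.prob_one]

lemma integral_mul [IsProbabilityMeasure P] (hU : IsBernoulliProcess P p U) (a : ℤ) (m : ℕ) :
    ∫ ω, U (a + m) ω * U a ω ∂P = samplingAcf p m := by
  unfold samplingAcf
  split_ifs with hm
  · rw [← hU.integral_eq a]
    refine integral_congr_ae ?_
    filter_upwards [hU.ae_eq_zero_or_one a] with ω hω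
    rcases hω with hω | hω <;> simp [hm, hω]
  · have hind : IndepFun (U (a + m)) (U a) P := hU.indep.indepFun (by omega)
    rw [hind.integral_fun_mul_eq_mul_integral (hU.measurable _).aestronglyMeasurable
      (hU.measurable _).aestronglyMeasurable, hU.integral_eq, hU.integral_eq, pow_two]

/-- Hoeffding's lemma for a variable in `[0, 1]`: the parameter is the squared half-width. -/
lemma hasSubgaussianMGF_mul [IsProbabilityMeasure P] (hU : IsBernoulliProcess P p U)
    (a : ℤ) (m : ℕ) :
    HasSubgaussianMGF (fun ω => U (a + m) ω * U a ω - samplingAcf p m) (1 / 4) P := by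
  have h := hasSubgaussianMGF_of_mem_Icc (μ := P) (X := fun ω => U (a + m) ω * U a ω)
    (a := 0) (b := 1) ((hU.measurable _).mul (hU.measurable _)).aemeasurable (by
      filter_upwards [hU.ae_eq_zero_or_one a, hU.ae_eq_zero_or_one (a + m)] with ω h1 h2
      rcases h1 with h1 | h1 <;> rcases h2 with h2 | h2 <;> simp [h1, h2])
  rw [hU.integral_mul] at h
  convert h using 1
  norm_num

/-- Lagged products over times that do not interlock are independent. -/
lemma hasSubgaussianMGF_sum [IsProbabilityMeasure P] (hU : IsBernoulliProcess P p U)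
    (t : ℤ) (m : ℕ) (s : Finset ℕ) (hs : ∀ n ∈ s, ∀ n' ∈ s, n ≠ n' → n + m ≠ n') :
    HasSubgaussianMGF (fun ω => ∑ n ∈ s, (U (t + n + m) ω * U (t + n) ω - samplingAcf p m))
      (s.card / 4) P := by
  classical
  induction s using Finset.induction_on with
  | empty => simp
  | insert n s hn ih =>
    have ih' := ih fun a ha b hb => hs a (Finset.mem_insert_of_mem ha) b (Finset.mem_insert_of_mem hb)
    have hV : iIndepFun (fun n : ℕ => U (t + n)) P :=
      hU.indep.precomp (g := fun n : ℕ => t + n) fun a b h => by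
        have : t + (a : ℤ) = t + b := h
        omega
    -- `S` and `R` collect the times read by the products over `s` and by the new product; the
    -- hypothesis on `s` makes them disjoint.
    let S : Finset ℕ := s ∪ s.image (· + m)
    let R : Finset ℕ := {n, n + m}
    have hSR : Disjoint S R := by
      rw [Finset.disjoint_left]
      intro j hjS hjR
      simp only [S, R, Finset.mem_union, Finset.mem_image, Finset.mem_insert,
        Finset.mem_singleton] at hjS hjR
      rcases hjS with hj | ⟨i, hi, rfl⟩
      · rcases hjR with rfl | rfl
        · exact hn hj
        · have hne : n ≠ n + m := fun h => hn (by rw [← h] at hj; exact hj)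
          exact hs n (Finset.mem_insert_self _ _) _ (Finset.mem_insert_of_mem hj) hne rfl
      · have hne : i ≠ n := fun h => hn (h ▸ hi)
        rcases hjR with h | h
        · exact hs i (Finset.mem_insert_of_mem hi) n (Finset.mem_insert_self _ _) hne h
        · exact hne (by omega)
    have hind := hV.indepFun_finset S R hSR fun _ => hU.measurable _
    -- Extension by zero makes the partial sums measurable functions of the coordinates in `Q`; the
    -- default value is never read.
    let ext (Q : Finset ℕ) (x : Q → ℝ) (j : ℕ) : ℝ := if h : j ∈ Q then x ⟨j, h⟩ else 0
    have hext : ∀ (Q : Finset ℕ) (j : ℕ), Measurable fun x : Q → ℝ => ext Q x j := by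
      intro Q j
      by_cases h : j ∈ Q
      · simp only [ext, h, dite_true]; exact measurable_pi_apply _
      · simp only [ext, h, dite_false]; exact measurable_const
    let φ (A : Finset ℕ) (Q : Finset ℕ) (x : Q → ℝ) : ℝ :=
      ∑ n ∈ A, (ext Q x (n + m) * ext Q x n - samplingAcf p m)
    have hφ : ∀ A Q, Measurable (φ A Q) := fun A Q =>
      Finset.measurable_sum _ fun i _ => ((hext Q _).mul (hext Q _)).sub_const _
    have hval : ∀ (A Q : Finset ℕ), A ⊆ Q → A.image (· + m) ⊆ Q → ∀ ω,
        φ A Q (fun i => U (t + (i : ℕ)) ω) =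
          ∑ n ∈ A, (U (t + n + m) ω * U (t + n) ω - samplingAcf p m) := by
      intro A Q h1 h2 ω
      refine Finset.sum_congr rfl fun i hi => ?_
      have hi1 : i ∈ Q := h1 hi
      have hi2 : i + m ∈ Q := h2 (Finset.mem_image_of_mem _ hi)
      simp only [ext, hi1, hi2, dite_true]
      push_cast
      rw [add_assoc]
    have hind' := (hind.comp (hφ s S) (hφ {n} R)).symm
    have e1 : φ s S ∘ (fun ω (i : S) => U (t + (i : ℕ)) ω) =
        fun ω => ∑ n ∈ s, (U (t + n + m) ω * U (t + n) ω - samplingAcf p m) := by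
      ext ω
      exact hval s S Finset.subset_union_left Finset.subset_union_right ω
    have e2 : φ {n} R ∘ (fun ω (i : R) => U (t + (i : ℕ)) ω) =
        fun ω => U (t + n + m) ω * U (t + n) ω - samplingAcf p m := by
      ext ω
      have := hval {n} R (by simp [R]) (by simp [R]) ω
      simpa using this
    rw [e1, e2] at hind'
    have h := (hU.hasSubgaussianMGF_mul (t + n) m).add_of_indepFun ih' hind'
    simp_rw [Finset.sum_insert hn]
    refine h.mono_param (le_of_eq ?_)
    rw [Finset.card_insert_of_notMem hn]
    push_cast
    ring

lemma measure_abs_sum_sub_ge_le [IsProbabilityMeasure P] (hU : IsBernoulliProcess P p U)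
    (t : ℤ) (m k M : ℕ) (hk : k ≤ M) {τ : ℝ} (hτ : 0 ≤ τ) :
    P.real {ω | τ ≤ |∑ n ∈ Finset.range k, (U (t + n + m) ω * U (t + n) ω - samplingAcf p m)|} ≤
      2 * Real.exp (-τ ^ 2 / M) := by
  classical
  let Y : ℕ → Ω → ℝ := fun n ω => U (t + n + m) ω * U (t + n) ω - samplingAcf p m
  -- Adding `m` changes the parity of the block index `n / m`, so products within one family share
  -- no factor. For `m = 0` the quotient is `0` and everything falls into `s1`.
  let s1 := (Finset.range k).filter fun n => Even (n / m)
  let s2 := (Finset.range k).filter fun n => ¬ Even (n / m)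
  have hdiv : ∀ n, m ≠ 0 → (n + m) / m = n / m + 1 := fun n h =>
    Nat.add_div_right n (Nat.pos_of_ne_zero h)
  have h1 := hU.hasSubgaussianMGF_sum t m s1 (by
    intro n hn n' hn' hne h
    rcases eq_or_ne m 0 with rfl | hm
    · exact hne (by simpa using h)
    · simp only [s1, Finset.mem_filter] at hn hn'
      rw [← h, hdiv n hm] at hn'
      exact (Nat.even_add_one.1 hn'.2) hn.2)
  have h2 := hU.hasSubgaussianMGF_sum t m s2 (by
    intro n hn n' hn' hne h
    rcases eq_or_ne m 0 with rfl | hm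
    · exact hne (by simpa using h)
    · simp only [s2, Finset.mem_filter] at hn hn'
      rw [← h, hdiv n hm] at hn'
      exact hn'.2 (Nat.even_add_one.2 hn.2))
  have hcard : s1.card + s2.card = k := by
    rw [Finset.card_filter_add_card_filter_not, Finset.card_range]
  -- The families are dependent, so the parameters combine as `(√x + √y)²`, which is at most `2(x +
  -- y) ≤ M/2`.
  have h3 := (h1.add h2).mono_param (d := M / 2) (by
    rw [← NNReal.coe_le_coe]
    push_cast
    have e1 := Real.sq_sqrt (show (0 : ℝ) ≤ s1.card / 4 by positivity)
    have e2 := Real.sq_sqrt (show (0 : ℝ) ≤ s2.card / 4 by positivity)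
    have e3 : (s1.card : ℝ) + s2.card ≤ M := by exact_mod_cast hcard.le.trans hk
    nlinarith [sq_nonneg (√((s1.card : ℝ) / 4) - √((s2.card : ℝ) / 4))])
  have hsum : (fun ω => ∑ n ∈ s1, Y n ω + ∑ n ∈ s2, Y n ω) =
      fun ω => ∑ n ∈ Finset.range k, Y n ω := by
    ext ω; exact Finset.sum_filter_add_sum_filter_not _ _ _
  change HasSubgaussianMGF (fun ω => ∑ n ∈ s1, Y n ω + ∑ n ∈ s2, Y n ω) _ _ at h3
  rw [hsum] at h3
  have b1 := h3.measure_ge_le hτ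
  have b2 := h3.neg.measure_ge_le hτ
  have hexp : -τ ^ 2 / (2 * ((M / 2 : ℝ≥0) : ℝ)) = -τ ^ 2 / M := by
    push_cast; congr 1; ring
  rw [hexp] at b1 b2
  have hsub : {ω | τ ≤ |∑ n ∈ Finset.range k, Y n ω|} ⊆
      {ω | τ ≤ ∑ n ∈ Finset.range k, Y n ω} ∪
        {ω | τ ≤ (-fun ω => ∑ n ∈ Finset.range k, Y n ω) ω} := by
    intro ω hω
    exact le_abs.1 (show τ ≤ |_| from hω)
  refine (measureReal_mono hsub).trans ((measureReal_union_le _ _).trans ?_)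
  linarith

end IsBernoulliProcess

/-! Trigonometric polynomials and autocorrelation functions. -/

lemma integral_cexp_two_pi_int (m : ℤ) :
    ∫ f in (0 : ℝ)..1, Complex.exp (2 * Real.pi * f * m * Complex.I) = if m = 0 then 1 else 0 := by
  split_ifs with hm
  · simp [hm]
  · have hc : (2 * Real.pi * m * Complex.I : ℂ) ≠ 0 := by
      simp [Real.pi_ne_zero, hm]
    have h := integral_exp_mul_complex (a := 0) (b := 1) hc
    have e : ∀ f : ℝ, (2 * Real.pi * f * m * Complex.I : ℂ) = 2 * Real.pi * m * Complex.I * f :=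
      fun f => by ring
    simp_rw [e]
    rw [h]
    have : (2 * Real.pi * m * Complex.I : ℂ) = m * (2 * Real.pi * Complex.I) := by ring
    simp [this, Complex.exp_int_mul_two_pi_mul_I]

lemma normSq_trigPoly {ι : Type*} (A : Finset ι) (k : ι → ℤ) (c : ι → ℂ) (f : ℝ) :
    ((‖∑ n ∈ A, c n * Complex.exp (2 * Real.pi * f * k n * Complex.I)‖ ^ 2 : ℝ) : ℂ) =
      ∑ n ∈ A, ∑ m ∈ A, c n * (starRingEnd ℂ) (c m) *
        Complex.exp (2 * Real.pi * f * ((k n - k m : ℤ) : ℂ) * Complex.I) := by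
  rw [← Complex.normSq_eq_norm_sq, Complex.normSq_eq_conj_mul_self, mul_comm, map_sum,
    Finset.sum_mul_sum]
  refine Finset.sum_congr rfl fun n _ => Finset.sum_congr rfl fun m _ => ?_
  rw [map_mul, ← Complex.exp_conj]
  have : (starRingEnd ℂ) (2 * Real.pi * f * k m * Complex.I) =
      -(2 * Real.pi * f * k m * Complex.I) := by
    have h2 : (starRingEnd ℂ) 2 = 2 := Complex.conj_ofReal 2
    simp [h2]
  rw [this, mul_mul_mul_comm, ← Complex.exp_add]
  congr 2
  push_cast
  ring

lemma continuous_trigPoly {ι : Type*} (A : Finset ι) (k : ι → ℤ) (c : ι → ℂ) :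
    Continuous fun f : ℝ => ∑ n ∈ A, c n * Complex.exp (2 * Real.pi * f * k n * Complex.I) := by
  fun_prop

/-- Parseval's identity for trigonometric polynomials. -/
lemma integral_normSq_trigPoly {ι : Type*} (A : Finset ι) {k : ι → ℤ}
    (hk : Function.Injective k) (c : ι → ℂ) :
    ∫ f in (0 : ℝ)..1, ‖∑ n ∈ A, c n * Complex.exp (2 * Real.pi * f * k n * Complex.I)‖ ^ 2 =
      ∑ n ∈ A, ‖c n‖ ^ 2 := by
  classical
  rw [← Complex.ofReal_inj, ← intervalIntegral.integral_ofReal]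
  simp_rw [normSq_trigPoly]
  have hi : ∀ n m, IntervalIntegrable (fun f : ℝ => c n * (starRingEnd ℂ) (c m) *
      Complex.exp (2 * Real.pi * f * ((k n - k m : ℤ) : ℂ) * Complex.I)) volume 0 1 :=
    fun n m => Continuous.intervalIntegrable (by fun_prop) _ _
  rw [intervalIntegral.integral_finsetSum fun n _ => by
    have := IntervalIntegrable.sum A fun m (_ : m ∈ A) => hi n m
    simpa [Finset.sum_fn] using this]
  rw [Complex.ofReal_sum]
  refine Finset.sum_congr rfl fun n hn => ?_
  rw [intervalIntegral.integral_finsetSum fun m _ => hi n m]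
  simp_rw [intervalIntegral.integral_const_mul, integral_cexp_two_pi_int, sub_eq_zero,
    hk.eq_iff]
  rw [← Complex.normSq_eq_norm_sq, Complex.normSq_eq_conj_mul_self]
  simp [hn, mul_comm]

/-! ### Normalized power spectral densities -/

namespace IsNormalizedPSD

variable {s : ℝ → ℝ}

lemma intervalIntegrable (hs : IsNormalizedPSD s) : IntervalIntegrable s volume 0 1 :=
  hs.continuous.intervalIntegrable _ _

lemma norm_acf_le_one (hs : IsNormalizedPSD s) (m : ℤ) : ‖acf s m‖ ≤ 1 := by
  unfold acf
  refine le_of_le_of_eq ?_ hs.integral_eq_one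
  refine (intervalIntegral.norm_integral_le_integral_norm zero_le_one).trans (le_of_eq ?_)
  refine intervalIntegral.integral_congr fun f _ => ?_
  have : Complex.exp (2 * Real.pi * f * m * Complex.I) =
      Complex.exp ((2 * Real.pi * f * m : ℝ) * Complex.I) := by push_cast; rfl
  simp only [norm_mul, this, Complex.norm_exp_ofReal_mul_I, mul_one, Complex.norm_real,
    Real.norm_eq_abs, abs_of_nonneg (hs.nonneg f)]

/-- The covariance form of a process with spectral density at most `B` is bounded by `B`. -/
lemma sum_acf_le (hs : IsNormalizedPSD s) {B : ℝ} (hB : ∀ f ∈ Set.Icc (0 : ℝ) 1, s f ≤ B)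
    {ι : Type*} (A : Finset ι) {k : ι → ℤ} (hk : Function.Injective k) (a : ι → ℝ) :
    (∑ n ∈ A, ∑ m ∈ A, (a n * a m : ℂ) * acf s (k n - k m)).re ≤ B * ∑ n ∈ A, a n ^ 2 := by
  have hi : ∀ n m, IntervalIntegrable (fun f : ℝ => (a n * a m : ℂ) *
      ((s f : ℂ) * Complex.exp (2 * Real.pi * f * ((k n - k m : ℤ) : ℂ) * Complex.I))) volume 0 1 :=
    fun n m => Continuous.intervalIntegrable (by have := hs.continuous; fun_prop) _ _
  -- The covariance form is the integral of `s` against the squared modulus of a trigonometric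
  -- polynomial, whose own integral Parseval gives.
  have h1 : ∑ n ∈ A, ∑ m ∈ A, (a n * a m : ℂ) * acf s (k n - k m) =
      ((∫ f in (0 : ℝ)..1, s f *
        ‖∑ n ∈ A, (a n : ℂ) * Complex.exp (2 * Real.pi * f * k n * Complex.I)‖ ^ 2 : ℝ) : ℂ) := by
    rw [← intervalIntegral.integral_ofReal]
    simp_rw [Complex.ofReal_mul, normSq_trigPoly, acf, Finset.mul_sum,
      ← intervalIntegral.integral_const_mul]
    rw [intervalIntegral.integral_finsetSum fun n _ => by
      exact Continuous.intervalIntegrable (by have := hs.continuous; fun_prop) _ _]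
    refine Finset.sum_congr rfl fun n _ => ?_
    rw [intervalIntegral.integral_finsetSum fun n _ => by
      exact Continuous.intervalIntegrable (by have := hs.continuous; fun_prop) _ _]
    refine Finset.sum_congr rfl fun m _ => intervalIntegral.integral_congr fun f _ => ?_
    simp only [Complex.conj_ofReal]
    ring
  rw [h1, Complex.ofReal_re]
  have hp := integral_normSq_trigPoly A hk fun n => (a n : ℂ)
  simp only [Complex.norm_real, Real.norm_eq_abs, sq_abs] at hp
  rw [← hp, ← intervalIntegral.integral_const_mul]
  have hc := continuous_trigPoly A k fun n => (a n : ℂ)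
  refine intervalIntegral.integral_mono_on zero_le_one
    (Continuous.intervalIntegrable (hs.continuous.mul (hc.norm.pow 2)) _ _)
    (Continuous.intervalIntegrable (continuous_const.mul (hc.norm.pow 2)) _ _) fun f hf => ?_
  exact mul_le_mul_of_nonneg_right (hB f hf) (sq_nonneg _)

/-- Up to the sign of the index, the autocorrelations are the Fourier coefficients of `s` on the
circle; being summable, they recover the continuous function pointwise. -/
lemma hasSum_acf (hs : IsNormalizedPSD s) (f : ℝ) :
    HasSum (fun m : ℤ => acf s m * Complex.exp (-(2 * Real.pi * f * m * Complex.I))) (s f) := by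
  have : Fact (0 < (1 : ℝ)) := ⟨one_pos⟩
  have hper : Function.Periodic (fun x => (s x : ℂ)) 1 := fun x => by simp only [hs.periodic x]
  let F : C(AddCircle (1 : ℝ), ℂ) := ⟨hper.lift, continuous_coinduced_dom.mpr (by
    have := hs.continuous
    show Continuous fun x => (s x : ℂ)
    fun_prop)⟩
  have hF : ∀ x : ℝ, F (x : AddCircle (1 : ℝ)) = s x := fun x => rfl
  have hcoef : ∀ m : ℤ, fourierCoeff F m = acf s (-m) := by
    intro m
    rw [fourierCoeff_eq_intervalIntegral _ _ 0, acf]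
    simp only [one_div, inv_one, one_smul, zero_add, fourier_coe_apply, hF, smul_eq_mul]
    refine intervalIntegral.integral_congr fun x _ => ?_
    rw [mul_comm]
    congr 2
    push_cast
    ring
  have hsum : Summable (fourierCoeff F) := by
    refine Summable.of_norm ?_
    simp_rw [hcoef]
    exact (Equiv.neg ℤ).summable_iff.2 hs.summable_acf
  have h := has_pointwise_sum_fourier_series_of_summable hsum (f : AddCircle (1 : ℝ))
  rw [hF, ← (Equiv.neg ℤ).hasSum_iff] at h
  convert h using 2 with m
  simp only [Function.comp, Equiv.neg_apply, hcoef, neg_neg, fourier_coe_apply, smul_eq_mul]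
  congr 2
  push_cast
  ring

/-- Compactness supplies the boundedness a real supremum needs, and periodicity covers the endpoint
`1`. -/
lemma le_iSup (hs : IsNormalizedPSD s) {f : ℝ} (hf : f ∈ Set.Icc (0 : ℝ) 1) :
    s f ≤ ⨆ f : Set.Ico (0 : ℝ) 1, s f := by
  have hbdd : BddAbove (Set.range fun f : Set.Ico (0 : ℝ) 1 => s f) := by
    obtain ⟨C, hC⟩ := (isCompact_Icc (a := (0 : ℝ)) (b := 1)).bddAbove_image
      hs.continuous.continuousOn
    refine ⟨C, ?_⟩
    rintro _ ⟨x, rfl⟩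
    exact hC ⟨x, Set.Ico_subset_Icc_self x.2, rfl⟩
  rcases eq_or_lt_of_le hf.2 with rfl | h
  · have : s 1 = s 0 := by simpa using hs.periodic 0
    rw [this]
    exact le_ciSup hbdd ⟨0, by simp⟩
  · exact le_ciSup hbdd ⟨f, hf.1, h⟩

lemma psdDist_le_one {s' : ℝ → ℝ} (hs : IsNormalizedPSD s) (hs' : IsNormalizedPSD s') :
    psdDist s s' ≤ 1 := by
  unfold psdDist
  have h : ∫ f in (0 : ℝ)..1, |s f - s' f| ≤ ∫ f in (0 : ℝ)..1, (s f + s' f) := by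
    refine intervalIntegral.integral_mono_on zero_le_one
      ((hs.continuous.sub hs'.continuous).abs.intervalIntegrable _ _)
      (hs.intervalIntegrable.add hs'.intervalIntegrable) fun f _ => ?_
    rw [abs_le]
    constructor <;> linarith [hs.nonneg f, hs'.nonneg f]
  rw [intervalIntegral.integral_add hs.intervalIntegrable hs'.intervalIntegrable,
    hs.integral_eq_one, hs'.integral_eq_one] at h
  linarith

lemma one_le_iSup (hs : IsNormalizedPSD s) : 1 ≤ ⨆ f : Set.Ico (0 : ℝ) 1, s f := by
  have h := intervalIntegral.integral_mono_on zero_le_one hs.intervalIntegrable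
    (intervalIntegrable_const (c := ⨆ f : Set.Ico (0 : ℝ) 1, s f)) fun f hf => hs.le_iSup hf
  rw [hs.integral_eq_one] at h
  simpa using h

end IsNormalizedPSD

/-! Concentration of the empirical autocorrelation. -/

lemma ProbabilityTheory.IsGaussianProcess.hasGaussianLaw_of_fintype {ι : Type*} [Fintype ι]
    {V : ι → Ω → ℝ} (hV : IsGaussianProcess V P) : HasGaussianLaw (fun ω i => V i ω) P := by
  let K : (↥(Finset.univ : Finset ι) → ℝ) →L[ℝ] (ι → ℝ) :=
    { toFun := fun x i => x ⟨i, Finset.mem_univ i⟩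
      map_add' := fun _ _ => rfl
      map_smul' := fun _ _ => rfl }
  exact (hV.hasGaussianLaw Finset.univ).map_fun K

lemma ProbabilityTheory.iIndepFun.gaussianProcess_of_hasGaussianLaw {T : Type*} {W : T → Ω → ℝ}
    (hW : iIndepFun W P) (hg : ∀ t, HasGaussianLaw (W t) P) : IsGaussianProcess W P where
  hasGaussianLaw I := iIndepFun.hasGaussianLaw (X := fun i : I => W i) (fun i => hg i)
    (hW.precomp Subtype.val_injective)

lemma ProbabilityTheory.IsGaussianProcess.add_of_indepFun {T : Type*} {X W : T → Ω → ℝ}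
    (hX : IsGaussianProcess X P) (hW : IsGaussianProcess W P)
    (h : IndepFun (fun ω t => X t ω) (fun ω t => W t ω) P) :
    IsGaussianProcess (fun t ω => X t ω + W t ω) P where
  hasGaussianLaw I := by
    have hind : IndepFun (fun ω => I.restrict (X · ω)) (fun ω => I.restrict (W · ω)) P :=
      h.comp (φ := I.restrict) (ψ := I.restrict) (by fun_prop) (by fun_prop)
    exact (IndepFun.hasGaussianLaw (hX.hasGaussianLaw I) (hW.hasGaussianLaw I) hind).fun_add

/-- Conditioning on one of two independent random variables. -/
lemma ProbabilityTheory.IndepFun.measureReal_le_of_ae {α β : Type*} [MeasurableSpace α]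
    [MeasurableSpace β] [IsProbabilityMeasure P] {U : Ω → α} {Y : Ω → β} (hUY : IndepFun U Y P)
    (hU : Measurable U) (hY : Measurable Y) {E : Set (α × β)} (hE : MeasurableSet E) {r : ℝ}
    (h : ∀ᵐ ω ∂P, P.real {ω' | (U ω, Y ω') ∈ E} ≤ r) :
    P.real {ω | (U ω, Y ω) ∈ E} ≤ r := by
  have hr : 0 ≤ r := by
    obtain ⟨ω, hω⟩ := h.exists
    exact measureReal_nonneg.trans hω
  have hmap := (indepFun_iff_map_prod_eq_prod_map_map hU.aemeasurable hY.aemeasurable).1 hUY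
  have := Measure.isProbabilityMeasure_map (μ := P) hU.aemeasurable
  have := Measure.isProbabilityMeasure_map (μ := P) hY.aemeasurable
  have h1 : P {ω | (U ω, Y ω) ∈ E} = ∫⁻ ω, P {ω' | (U ω, Y ω') ∈ E} ∂P := by
    have e : P {ω | (U ω, Y ω) ∈ E} = P.map (fun ω => (U ω, Y ω)) E :=
      (Measure.map_apply (hU.prodMk hY) hE).symm
    rw [e, hmap, Measure.prod_apply hE, lintegral_map (measurable_measure_prodMk_left hE) hU]
    refine lintegral_congr fun ω => ?_
    rw [Measure.map_apply hY (measurable_prodMk_left hE)]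
    rfl
  have h2 : P {ω | (U ω, Y ω) ∈ E} ≤ ENNReal.ofReal r := by
    rw [h1]
    calc ∫⁻ ω, P {ω' | (U ω, Y ω') ∈ E} ∂P ≤ ∫⁻ _, ENNReal.ofReal r ∂P := by
          refine lintegral_mono_ae ?_
          filter_upwards [h] with ω hω
          rw [← ENNReal.ofReal_toReal (measure_ne_top P _)]
          exact ENNReal.ofReal_le_ofReal hω
      _ = ENNReal.ofReal r := by simp
  exact ENNReal.toReal_le_of_le_ofReal hr h2

/-- Lagged products of a centred Gaussian process, weighted by fixed numbers in `[-1, 1]`: the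
polarization identity reduces them to squared norms of Gaussian vectors. -/
lemma measure_abs_sum_lag_sub_ge_le {Y : ℤ → Ω → ℝ} (hY : IsGaussianProcess Y P)
    (hYm : ∀ n, Measurable (Y n)) (hY0 : ∀ n, ∫ ω, Y n ω ∂P = 0) {C : ℤ → ℝ}
    (hC : ∀ m n, ∫ ω, Y m ω * Y n ω ∂P = C (m - n)) {b c : ℝ} (hb0 : 0 ≤ b) (hc : C 0 ≤ c)
    (hb : ∀ (t : ℤ) (k : ℕ) (a : Fin k → ℝ),
      ∫ ω, (∑ n, a n * Y (t + (n : ℕ)) ω) ^ 2 ∂P ≤ b * ∑ n, a n ^ 2)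
    (t : ℤ) (m k M : ℕ) (hk : k ≤ M) (w : Fin k → ℝ) (hw : ∀ n, |w n| ≤ 1) {θ τ : ℝ}
    (hθ0 : 0 ≤ θ) (hθ : θ * b ≤ 1 / 6) :
    P.real {ω | 2 * τ ≤ |∑ n : Fin k, w n ^ 2 *
        (Y (t + (n : ℕ) + m) ω * Y (t + (n : ℕ)) ω - C m)|} ≤
      4 * Real.exp (2 * θ ^ 2 * (b * (M * c)) - θ * τ) := by
  have := hY.isProbabilityMeasure
  have hY2 : ∀ n, MemLp (Y n) 2 P := fun n => (hY.hasGaussianLaw_eval n).memLp_two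
  have hYsq : ∀ n, ∫ ω, Y n ω ^ 2 ∂P ≤ c := by
    intro n
    simp_rw [pow_two]
    rw [hC, sub_self]; exact hc
  have hc0 : 0 ≤ c := (integral_nonneg fun _ => sq_nonneg _).trans (hYsq 0)
  have hw2 : ∀ n, w n ^ 2 ≤ 1 := fun n => by
    rw [← sq_abs]; exact pow_le_one₀ (abs_nonneg _) (hw n)
  -- For `ε = ±1` these are the polarization vectors: `V 1 n ^ 2 - V (-1) n ^ 2` is the weighted lag
  -- product, which is why the weight appears squared.
  let V (ε : ℝ) (n : Fin k) (ω : Ω) : ℝ :=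
    w n / 2 * (Y (t + (n : ℕ) + m) ω + ε * Y (t + (n : ℕ)) ω)
  have hVm : ∀ ε n, Measurable (V ε n) := fun ε n =>
    ((hYm _).add ((hYm _).const_mul _)).const_mul _
  have hV2 : ∀ ε n, MemLp (V ε n) 2 P := fun ε n =>
    ((hY2 _).add ((hY2 _).const_mul _)).const_mul _
  have hVg : ∀ ε, HasGaussianLaw (fun ω n => V ε n ω) P := by
    intro ε
    classical
    refine (hY.of_isGaussianProcess fun n => ?_ :
      IsGaussianProcess (V ε) P).hasGaussianLaw_of_fintype
    refine ⟨{t + (n : ℕ) + m, t + (n : ℕ)},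
      { toFun := fun x => w n / 2 * (x ⟨t + (n : ℕ) + m, by simp⟩ + ε * x ⟨t + (n : ℕ), by simp⟩)
        map_add' := fun x y => by simp; ring
        map_smul' := fun r x => by simp; ring }, fun ω => rfl⟩
  have hV0 : ∀ ε n, ∫ ω, V ε n ω ∂P = 0 := by
    intro ε n
    simp only [V]
    rw [integral_const_mul, integral_add ((hY2 _).integrable one_le_two)
      (((hY2 _).integrable one_le_two).const_mul _), integral_const_mul, hY0, hY0]
    simp
  have hVβ : ∀ ε, ε ^ 2 = 1 → ∀ a : Fin k → ℝ,
      ∫ ω, (∑ n, a n * V ε n ω) ^ 2 ∂P ≤ b * ∑ n, a n ^ 2 := by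
    intro ε hε a
    let S (t' : ℤ) (ω : Ω) : ℝ := ∑ n : Fin k, a n * w n * Y (t' + (n : ℕ)) ω
    have hS2 : ∀ t', MemLp (S t') 2 P := fun t' =>
      memLp_finsetSum _ fun n _ => (hY2 _).const_mul _
    have hSb : ∀ t', ∫ ω, S t' ω ^ 2 ∂P ≤ b * ∑ n, a n ^ 2 := by
      intro t'
      refine (hb t' k fun n => a n * w n).trans (mul_le_mul_of_nonneg_left ?_ hb0)
      refine Finset.sum_le_sum fun n _ => ?_
      rw [mul_pow]
      exact mul_le_of_le_one_right (sq_nonneg _) (hw2 n)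
    have hVS : ∀ ω, ∑ n, a n * V ε n ω = (S (t + m) ω + ε * S t ω) / 2 := by
      intro ω
      simp only [S, V, Finset.mul_sum, Finset.sum_div, ← Finset.sum_add_distrib]
      refine Finset.sum_congr rfl fun n _ => ?_
      rw [add_right_comm t (m : ℤ)]
      ring
    -- The form is that of an average of two shifted blocks; `((x + εy)/2)² ≤ (x² + y²)/2` gives the
    -- bound `b` for each sign, with no loss from the overlap of the blocks.
    calc ∫ ω, (∑ n, a n * V ε n ω) ^ 2 ∂P
        ≤ ∫ ω, ((1 / 2) * S (t + m) ω ^ 2 + (1 / 2) * S t ω ^ 2) ∂P := by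
          refine integral_mono (memLp_finsetSum _ fun n _ => (hV2 ε n).const_mul _).integrable_sq
            (((hS2 _).integrable_sq.const_mul _).add ((hS2 _).integrable_sq.const_mul _))
            fun ω => ?_
          simp only [hVS]
          nlinarith [sq_nonneg (S (t + m) ω - ε * S t ω)]
      _ ≤ b * ∑ n, a n ^ 2 := by
          rw [integral_add ((hS2 _).integrable_sq.const_mul _)
            ((hS2 _).integrable_sq.const_mul _), integral_const_mul, integral_const_mul]
          linarith [hSb t, hSb (t + m)]
  have hVT : ∀ ε, ε ^ 2 = 1 → ∑ n, ∫ ω, V ε n ω ^ 2 ∂P ≤ M * c := by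
    intro ε hε
    have h1 : ∀ n, ∫ ω, V ε n ω ^ 2 ∂P ≤ c := by
      intro n
      calc ∫ ω, V ε n ω ^ 2 ∂P
          ≤ ∫ ω, ((1 / 2) * Y (t + (n : ℕ) + m) ω ^ 2 + (1 / 2) * Y (t + (n : ℕ)) ω ^ 2) ∂P := by
            refine integral_mono (hV2 ε n).integrable_sq
              (((hY2 _).integrable_sq.const_mul _).add ((hY2 _).integrable_sq.const_mul _))
              fun ω => ?_
            have e : V ε n ω ^ 2 = w n ^ 2 *
                ((Y (t + (n : ℕ) + m) ω + ε * Y (t + (n : ℕ)) ω) / 2) ^ 2 := by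
              simp only [V]; ring
            simp only [e]
            refine (mul_le_of_le_one_left (sq_nonneg _) (hw2 n)).trans ?_
            nlinarith [sq_nonneg (Y (t + (n : ℕ) + m) ω - ε * Y (t + (n : ℕ)) ω)]
        _ ≤ c := by
            rw [integral_add ((hY2 _).integrable_sq.const_mul _)
              ((hY2 _).integrable_sq.const_mul _), integral_const_mul, integral_const_mul]
            linarith [hYsq (t + (n : ℕ)), hYsq (t + (n : ℕ) + m)]
    refine (Finset.sum_le_sum fun n _ => h1 n).trans ?_
    simp only [Finset.sum_const, Finset.card_univ, Fintype.card_fin, nsmul_eq_mul]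
    gcongr
  have hpol : ∀ n ω, V 1 n ω ^ 2 - V (-1) n ω ^ 2 =
      w n ^ 2 * (Y (t + (n : ℕ) + m) ω * Y (t + (n : ℕ)) ω) := fun n ω => by
    simp only [V]; ring
  have hpolE : ∀ n, ∫ ω, V 1 n ω ^ 2 ∂P - ∫ ω, V (-1) n ω ^ 2 ∂P = w n ^ 2 * C m := by
    intro n
    rw [← integral_sub (hV2 _ _).integrable_sq (hV2 _ _).integrable_sq]
    simp_rw [hpol]
    rw [integral_const_mul, hC, add_sub_cancel_left]
  have hsum : ∀ ω, ∑ n : Fin k, w n ^ 2 *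
      (Y (t + (n : ℕ) + m) ω * Y (t + (n : ℕ)) ω - C m) =
      (∑ n, V 1 n ω ^ 2 - ∑ n, ∫ ω, V 1 n ω ^ 2 ∂P) -
        (∑ n, V (-1) n ω ^ 2 - ∑ n, ∫ ω, V (-1) n ω ^ 2 ∂P) := by
    intro ω
    rw [sub_sub_sub_comm, ← Finset.sum_sub_distrib, ← Finset.sum_sub_distrib,
      ← Finset.sum_sub_distrib]
    refine Finset.sum_congr rfl fun n _ => ?_
    rw [hpol, hpolE]; ring
  have h1 := measure_abs_sum_sq_sub_ge_le (τ := τ) (hVg 1) (hVm 1) (hV0 1) (hVβ 1 (by norm_num))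
    (hVT 1 (by norm_num)) hb0 hθ0 hθ
  have h2 := measure_abs_sum_sq_sub_ge_le (τ := τ) (hVg (-1)) (hVm (-1)) (hV0 (-1))
    (hVβ (-1) (by norm_num)) (hVT (-1) (by norm_num)) hb0 hθ0 hθ
  refine (measureReal_mono (s₂ := {ω | τ ≤ |∑ n, V 1 n ω ^ 2 - ∑ n, ∫ ω, V 1 n ω ^ 2 ∂P|} ∪
    {ω | τ ≤ |∑ n, V (-1) n ω ^ 2 - ∑ n, ∫ ω, V (-1) n ω ^ 2 ∂P|}) ?_).trans
    ((measureReal_union_le _ _).trans ?_)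
  · intro ω hω
    rw [Set.mem_ofPred_eq, hsum] at hω
    have := hω.trans (abs_sub _ _)
    by_contra hcon
    simp only [Set.mem_union, Set.mem_ofPred_eq, not_or, not_le] at hcon
    linarith [hcon.1, hcon.2]
  · linarith

/-! Realizations of the generative model. -/

/-- The autocovariance of signal plus noise. -/
noncomputable def noisyAcf (σ : ℝ≥0) (s : ℝ → ℝ) (m : ℤ) : ℝ :=
  (acf s m).re + if m = 0 then (σ : ℝ) ^ 2 else 0

lemma IsNormalizedPSD.abs_noisyAcf_le {σ : ℝ≥0} {s : ℝ → ℝ}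
    (hs : IsNormalizedPSD s) (m : ℤ) :
    |noisyAcf σ s m| ≤ 1 + (σ : ℝ) ^ 2 := by
  unfold noisyAcf
  refine (abs_add_le _ _).trans (add_le_add ((Complex.abs_re_le_norm _).trans
    (hs.norm_acf_le_one m)) ?_)
  split_ifs
  · rw [abs_of_nonneg (by positivity)]
  · simp

namespace IsRealization

variable {p : ℝ} {σ : ℝ≥0} {s : ℝ → ℝ} {U X W : ℤ → Ω → ℝ}

lemma indepFun_signal_noise (h : IsRealization P p σ s U X W) :
    IndepFun (fun ω m => X m ω) (fun ω m => W m ω) P :=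
  h.indep.indepFun (i := 1) (j := 2) (by decide)

lemma indepFun_sampling (h : IsRealization P p σ s U X W) :
    IndepFun (fun ω m => U m ω) (fun ω m => X m ω + W m ω) P := by
  have hm : ∀ k : Fin 3, Measurable fun (ω : Ω) (m : ℤ) => (![U, X, W] k) m ω := by
    intro k
    refine measurable_pi_lambda _ fun m => ?_
    fin_cases k
    · exact h.sampling.measurable m
    · exact h.signal.measurable m
    · exact h.noise.measurable m
  have h1 := h.indep.indepFun_prodMk hm 1 2 0 (by decide) (by decide)
  exact (h1.comp (φ := fun (x : (ℤ → ℝ) × (ℤ → ℝ)) m => x.1 m + x.2 m) (ψ := id)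
    (by fun_prop) measurable_id).symm

lemma hasGaussianLaw_noise (h : IsRealization P p σ s U X W) (m : ℤ) :
    HasGaussianLaw (W m) P := ⟨by rw [h.noise.law]; infer_instance⟩

lemma isGaussianProcess_noisy (h : IsRealization P p σ s U X W) :
    IsGaussianProcess (fun m ω => X m ω + W m ω) P :=
  h.signal.gaussian.add_of_indepFun
    (h.noise.indep.gaussianProcess_of_hasGaussianLaw h.hasGaussianLaw_noise) h.indepFun_signal_noise

lemma measurable_noisy (h : IsRealization P p σ s U X W) (m : ℤ) :
    Measurable fun ω => X m ω + W m ω :=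
  (h.signal.measurable m).add (h.noise.measurable m)

lemma memLp_signal (h : IsRealization P p σ s U X W) (m : ℤ) : MemLp (X m) 2 P :=
  (h.signal.gaussian.hasGaussianLaw_eval m).memLp_two

lemma memLp_noise (h : IsRealization P p σ s U X W) (m : ℤ) : MemLp (W m) 2 P :=
  (h.hasGaussianLaw_noise m).memLp_two

lemma integral_noise (h : IsRealization P p σ s U X W) (m : ℤ) : ∫ ω, W m ω ∂P = 0 := by
  have := integral_map (μ := P) (h.noise.measurable m).aemeasurable
    (f := fun x : ℝ => x) aestronglyMeasurable_id
  rw [h.noise.law, integral_id_gaussianReal] at this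
  exact this.symm

lemma integral_noisy [IsProbabilityMeasure P] (h : IsRealization P p σ s U X W) (m : ℤ) :
    ∫ ω, (X m ω + W m ω) ∂P = 0 := by
  rw [integral_add ((h.memLp_signal m).integrable one_le_two)
    ((h.memLp_noise m).integrable one_le_two), h.signal.mean, h.integral_noise, add_zero]

lemma integral_noise_mul [IsProbabilityMeasure P] (h : IsRealization P p σ s U X W) (m n : ℤ) :
    ∫ ω, W m ω * W n ω ∂P = if m - n = 0 then (σ : ℝ) ^ 2 else 0 := by
  split_ifs with hmn
  · obtain rfl : m = n := by omega
    have h1 : Var[W m; P] = (σ : ℝ) ^ 2 := by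
      have h2 := variance_map (μ := P) (X := fun x : ℝ => x) (Y := W m)
        aemeasurable_id (h.noise.measurable m).aemeasurable
      rw [h.noise.law, variance_fun_id_gaussianReal] at h2
      rw [show W m = (fun x : ℝ => x) ∘ W m from rfl, ← h2]
      push_cast; rfl
    rw [← h1, variance_of_integral_eq_zero (h.noise.measurable m).aemeasurable
      (h.integral_noise m)]
    simp_rw [pow_two]
  · have hi : IndepFun (W m) (W n) P := h.noise.indep.indepFun (by omega)
    rw [hi.integral_fun_mul_eq_mul_integral (h.noise.measurable m).aestronglyMeasurable
      (h.noise.measurable n).aestronglyMeasurable, h.integral_noise, zero_mul]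

lemma integral_signal_mul (h : IsRealization P p σ s U X W) (m n : ℤ) :
    ∫ ω, X m ω * X n ω ∂P = (acf s (m - n)).re := by
  rw [← h.signal.cov, Complex.ofReal_re]

lemma integral_signal_mul_noise [IsProbabilityMeasure P] (h : IsRealization P p σ s U X W)
    (m n : ℤ) : ∫ ω, X m ω * W n ω ∂P = 0 := by
  have hi : IndepFun (X m) (W n) P :=
    h.indepFun_signal_noise.comp (measurable_pi_apply m) (measurable_pi_apply n)
  rw [hi.integral_fun_mul_eq_mul_integral (h.signal.measurable m).aestronglyMeasurable
    (h.noise.measurable n).aestronglyMeasurable, h.integral_noise, mul_zero]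

lemma integral_noisy_mul [IsProbabilityMeasure P] (h : IsRealization P p σ s U X W) (m n : ℤ) :
    ∫ ω, (X m ω + W m ω) * (X n ω + W n ω) ∂P = noisyAcf σ s (m - n) := by
  have e : ∀ ω, (X m ω + W m ω) * (X n ω + W n ω) =
      (X m ω * X n ω + W m ω * W n ω) + (X m ω * W n ω + X n ω * W m ω) := fun ω => by ring
  have i1 : Integrable (fun ω => X m ω * X n ω) P :=
    (h.memLp_signal m).integrable_mul (h.memLp_signal n)
  have i2 : Integrable (fun ω => W m ω * W n ω) P :=
    (h.memLp_noise m).integrable_mul (h.memLp_noise n)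
  have i3 : Integrable (fun ω => X m ω * W n ω) P :=
    (h.memLp_signal m).integrable_mul (h.memLp_noise n)
  have i4 : Integrable (fun ω => X n ω * W m ω) P :=
    (h.memLp_signal n).integrable_mul (h.memLp_noise m)
  have i12 : Integrable (fun ω => X m ω * X n ω + W m ω * W n ω) P := i1.add i2
  have i34 : Integrable (fun ω => X m ω * W n ω + X n ω * W m ω) P := i3.add i4
  simp_rw [e]
  rw [integral_add i12 i34, integral_add i1 i2, integral_add i3 i4,
    h.integral_signal_mul, h.integral_noise_mul, h.integral_signal_mul_noise,
    h.integral_signal_mul_noise, noisyAcf]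
  ring

/-- The covariance is a sum: the signal part is controlled by the spectral bound, and white noise
adds `σ²` on the diagonal. -/
lemma integral_sum_sq_le [IsProbabilityMeasure P] (h : IsRealization P p σ s U X W)
    (hs : IsNormalizedPSD s) {B : ℝ} (hB : ∀ f ∈ Set.Icc (0 : ℝ) 1, s f ≤ B)
    (t : ℤ) (k : ℕ) (a : Fin k → ℝ) :
    ∫ ω, (∑ n, a n * (X (t + (n : ℕ)) ω + W (t + (n : ℕ)) ω)) ^ 2 ∂P ≤
      (B + (σ : ℝ) ^ 2) * ∑ n, a n ^ 2 := by
  have hY2 : ∀ n, MemLp (fun ω => X n ω + W n ω) 2 P := fun n =>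
    (h.memLp_signal n).add (h.memLp_noise n)
  have hYY : ∀ i j, Integrable (fun ω => (X i ω + W i ω) * (X j ω + W j ω)) P := fun i j =>
    (hY2 i).integrable_mul (hY2 j)
  have hinj : Function.Injective fun n : Fin k => t + ((n : ℕ) : ℤ) := fun i j hij => by
    have : t + ((i : ℕ) : ℤ) = t + ((j : ℕ) : ℤ) := hij
    ext; omega
  have e : ∀ ω, (∑ n, a n * (X (t + (n : ℕ)) ω + W (t + (n : ℕ)) ω)) ^ 2 =
      ∑ i : Fin k, ∑ j : Fin k, a i * a j *
        ((X (t + (i : ℕ)) ω + W (t + (i : ℕ)) ω) * (X (t + (j : ℕ)) ω + W (t + (j : ℕ)) ω)) := by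
    intro ω
    rw [pow_two, Finset.sum_mul_sum]
    exact Finset.sum_congr rfl fun i _ => Finset.sum_congr rfl fun j _ => by ring
  simp_rw [e]
  rw [integral_finsetSum _ fun i _ => integrable_finsetSum _ fun j _ => (hYY _ _).const_mul _]
  have e2 : ∀ i : Fin k, ∫ ω, ∑ j : Fin k, a i * a j *
        ((X (t + (i : ℕ)) ω + W (t + (i : ℕ)) ω) * (X (t + (j : ℕ)) ω + W (t + (j : ℕ)) ω)) ∂P =
      ∑ j : Fin k, a i * a j * (acf s (t + (i : ℕ) - (t + (j : ℕ)))).re + σ ^ 2 * a i ^ 2 := by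
    intro i
    rw [integral_finsetSum _ fun j _ => (hYY _ _).const_mul _]
    simp_rw [integral_const_mul, h.integral_noisy_mul, noisyAcf, mul_add, Finset.sum_add_distrib,
      sub_eq_zero]
    congr 1
    have : ∀ j : Fin k, (t + ((i : ℕ) : ℤ) = t + ((j : ℕ) : ℤ)) ↔ i = j := fun j =>
      ⟨fun hij => hinj hij, fun hij => by rw [hij]⟩
    simp_rw [this]
    simp
    ring
  simp_rw [e2]
  rw [Finset.sum_add_distrib, ← Finset.mul_sum, add_mul]
  gcongr
  refine le_trans (le_of_eq ?_) (hs.sum_acf_le hB Finset.univ hinj a)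
  rw [Complex.re_sum]
  refine Finset.sum_congr rfl fun i _ => ?_
  rw [Complex.re_sum]
  refine Finset.sum_congr rfl fun j _ => ?_
  rw [← Complex.ofReal_mul, Complex.re_ofReal_mul]

end IsRealization

namespace IsRealization

variable [IsProbabilityMeasure P]
  {p : ℝ} {σ : ℝ≥0} {s : ℝ → ℝ} {U X W : ℤ → Ω → ℝ}

/-- Given the sampling process, the factors `UU'` are fixed weights in `{0, 1}`, equal to their own
squares, so the bound for fixed weights applies. It does not depend on the weights and survives
averaging. -/
lemma measure_abs_sum_sampled_lag_ge_le (h : IsRealization P p σ s U X W)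
    (hs : IsNormalizedPSD s) {b : ℝ} (hb : ∀ f ∈ Set.Icc (0 : ℝ) 1, s f + (σ : ℝ) ^ 2 ≤ b)
    (t : ℤ) (m k M : ℕ) (hk : k ≤ M) {θ τ : ℝ} (hθ0 : 0 ≤ θ) (hθ : θ * b ≤ 1 / 6) :
    P.real {ω | 2 * τ ≤ |∑ n : Fin k, U (t + (n : ℕ) + m) ω * U (t + (n : ℕ)) ω *
        ((X (t + (n : ℕ) + m) ω + W (t + (n : ℕ) + m) ω) *
          (X (t + (n : ℕ)) ω + W (t + (n : ℕ)) ω) - noisyAcf σ s m)|} ≤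
      4 * Real.exp (2 * θ ^ 2 * (b * (M * (1 + (σ : ℝ) ^ 2))) - θ * τ) := by
  have hb0 : 0 ≤ b := by
    have := hb 0 (by simp)
    have := hs.nonneg 0
    nlinarith [sq_nonneg (σ : ℝ)]
  let E : Set ((ℤ → ℝ) × (ℤ → ℝ)) := {z | 2 * τ ≤ |∑ n : Fin k,
    z.1 (t + (n : ℕ) + m) * z.1 (t + (n : ℕ)) *
      (z.2 (t + (n : ℕ) + m) * z.2 (t + (n : ℕ)) - noisyAcf σ s m)|}
  have hE : MeasurableSet E := by
    refine measurableSet_le measurable_const ?_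
    fun_prop
  have hU : Measurable fun ω m => U m ω := measurable_pi_lambda _ h.sampling.measurable
  have hY : Measurable fun ω m => X m ω + W m ω := measurable_pi_lambda _ h.measurable_noisy
  refine h.indepFun_sampling.measureReal_le_of_ae hU hY hE ?_
  filter_upwards [ae_all_iff.2 h.sampling.ae_eq_zero_or_one] with ω hω
  have hw : ∀ n : Fin k, |U (t + (n : ℕ) + m) ω * U (t + (n : ℕ)) ω| ≤ 1 ∧
      (U (t + (n : ℕ) + m) ω * U (t + (n : ℕ)) ω) ^ 2 =
        U (t + (n : ℕ) + m) ω * U (t + (n : ℕ)) ω := by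
    intro n
    rcases hω (t + (n : ℕ) + m) with h1 | h1 <;> rcases hω (t + (n : ℕ)) with h2 | h2 <;>
      simp [h1, h2]
  have key := measure_abs_sum_lag_sub_ge_le h.isGaussianProcess_noisy h.measurable_noisy
    h.integral_noisy h.integral_noisy_mul hb0
    ((le_abs_self _).trans (hs.abs_noisyAcf_le (σ := σ) 0))
    (fun t k a => by
      have := h.integral_sum_sq_le hs (B := b - (σ : ℝ) ^ 2)
        (fun f hf => by linarith [hb f hf]) t k a
      simpa using this)
    t m k M hk (fun n => U (t + (n : ℕ) + m) ω * U (t + (n : ℕ)) ω) (fun n => (hw n).1)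
    (τ := τ) hθ0 hθ
  simp only [fun n => (hw n).2] at key
  exact key

/-- Concentration of one lag of the unnormalized empirical autocorrelation. -/
theorem measure_abs_lag_ge_le (h : IsRealization P p σ s U X W)
    (hs : IsNormalizedPSD s) {b : ℝ} (hb : ∀ f ∈ Set.Icc (0 : ℝ) 1, s f + (σ : ℝ) ^ 2 ≤ b)
    (hb1 : 1 ≤ b) (t : ℤ) (m k M : ℕ) (hM : 1 ≤ M) (hk : k ≤ M) {r : ℝ} (hr0 : 0 ≤ r)
    (hr : M * r ^ 2 = Real.log M) (hrb : r * b ≤ 1 / 6) :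
    P.real {ω | M * ((5 * b + 7 * (1 + (σ : ℝ) ^ 2)) * r) ≤
        |∑ n : Fin k, (U (t + (n : ℕ) + m) ω * (X (t + (n : ℕ) + m) ω + W (t + (n : ℕ) + m) ω)) *
          (U (t + (n : ℕ)) ω * (X (t + (n : ℕ)) ω + W (t + (n : ℕ)) ω)) -
          k * (samplingAcf p m * noisyAcf σ s m)|} ≤ 6 / (M : ℝ) ^ 3 := by
  set c : ℝ := 1 + (σ : ℝ) ^ 2 with hc
  have hc1 : 1 ≤ c := by nlinarith [sq_nonneg (σ : ℝ)]
  have hMpos : (0 : ℝ) < M := by exact_mod_cast hM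
  have hlog : 0 ≤ Real.log M := Real.log_nonneg (by exact_mod_cast hM)
  set d := √(b * c) with hd
  have hdsq : d ^ 2 = b * c := Real.sq_sqrt (by positivity)
  have hd1 : 1 ≤ d := Real.one_le_sqrt.2 (by nlinarith)
  have hdle : 2 * d ≤ b + c := by nlinarith [sq_nonneg (b - c)]
  -- With `d² = bc` the Chernoff exponent becomes `2Mr² - 5Mr² = -3 log M`. Since `d ≥ 1`, the
  -- condition on `θ` follows from `r b ≤ 1/6`.
  have hG := h.measure_abs_sum_sampled_lag_ge_le hs hb t m k M hk (θ := r / d)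
    (τ := 5 * d * M * r) (by positivity) (by
      refine le_trans ?_ hrb
      gcongr
      exact div_le_self hr0 hd1)
  have hexp3 : Real.exp (-(3 * Real.log M)) = 1 / (M : ℝ) ^ 3 := by
    have h3 : 3 * Real.log M = Real.log ((M : ℝ) ^ 3) := by rw [Real.log_pow]; norm_num
    rw [Real.exp_neg, h3, Real.exp_log (by positivity), one_div]
  have e1 : 2 * (r / d) ^ 2 * (b * (M * (1 + (σ : ℝ) ^ 2))) - r / d * (5 * d * M * r) =
      -(3 * Real.log M) := by
    rw [← hc, ← hr, div_pow, hdsq]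
    field_simp
    ring
  rw [e1, hexp3] at hG
  -- This deviation has probability at most `2 / M⁴`; only `2 / M³` is used.
  have hS := h.sampling.measure_abs_sum_sub_ge_le t m k M hk (τ := 2 * M * r) (by positivity)
  have hS' : 2 * Real.exp (-(2 * M * r) ^ 2 / M) ≤ 2 * (1 / (M : ℝ) ^ 3) := by
    rw [← hexp3]
    gcongr
    have : -(2 * M * r) ^ 2 / M = -(4 * (M * r ^ 2)) := by field_simp; ring
    rw [this, hr]
    linarith
  refine (measureReal_mono (s₂ := {ω | 2 * (5 * d * M * r) ≤
      |∑ n : Fin k, U (t + (n : ℕ) + m) ω * U (t + (n : ℕ)) ω *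
        ((X (t + (n : ℕ) + m) ω + W (t + (n : ℕ) + m) ω) *
          (X (t + (n : ℕ)) ω + W (t + (n : ℕ)) ω) - noisyAcf σ s m)|} ∪
      {ω | 2 * M * r ≤ |∑ n ∈ Finset.range k,
        (U (t + n + m) ω * U (t + n) ω - samplingAcf p m)|}) ?_).trans
    ((measureReal_union_le _ _).trans ?_)
  · intro ω hω
    by_contra hcon
    simp only [Set.mem_union, Set.mem_ofPred_eq, not_or, not_le] at hcon hω
    obtain ⟨hg, hu⟩ := hcon
    rw [Finset.sum_range] at hu
    have hid : ∑ n : Fin k,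
        (U (t + (n : ℕ) + m) ω * (X (t + (n : ℕ) + m) ω + W (t + (n : ℕ) + m) ω)) *
          (U (t + (n : ℕ)) ω * (X (t + (n : ℕ)) ω + W (t + (n : ℕ)) ω)) -
          k * (samplingAcf p m * noisyAcf σ s m) =
        (∑ n : Fin k, U (t + (n : ℕ) + m) ω * U (t + (n : ℕ)) ω *
          ((X (t + (n : ℕ) + m) ω + W (t + (n : ℕ) + m) ω) *
            (X (t + (n : ℕ)) ω + W (t + (n : ℕ)) ω) - noisyAcf σ s m)) +
        noisyAcf σ s m * ∑ n : Fin k,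
          (U (t + (n : ℕ) + m) ω * U (t + (n : ℕ)) ω - samplingAcf p m) := by
      rw [Finset.mul_sum, ← Finset.sum_add_distrib]
      have : (k : ℝ) * (samplingAcf p m * noisyAcf σ s m) =
          ∑ _n : Fin k, samplingAcf p m * noisyAcf σ s m := by simp
      rw [this, ← Finset.sum_sub_distrib]
      exact Finset.sum_congr rfl fun n _ => by ring
    rw [hid] at hω
    have h1 := hω.trans (abs_add_le _ _)
    rw [abs_mul] at h1
    have h2 := mul_le_mul (hs.abs_noisyAcf_le (σ := σ) m) hu.le (abs_nonneg _)
      (by positivity)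
    rw [← hc] at h2
    -- By the arithmetic-geometric mean inequality the Gaussian part `10 d M r` is at most `5(b + c)
    -- M r`. The sampling part adds `2 c M r`, whence `5b + 7c`.
    have h3 : M * r * (2 * d) ≤ M * r * (b + c) := by gcongr
    nlinarith
  · refine (add_le_add hG (hS.trans hS')).trans (le_of_eq ?_)
    ring

end IsRealization

/-! Error of the spectral estimate. -/

/-- Cauchy–Schwarz on the unit interval, in the form that the variance of `‖F‖` is nonnegative. -/
lemma intervalIntegral_norm_le_of_sq_le {F : ℝ → ℂ} (hF : Continuous F) {K : ℝ} (hK : 0 ≤ K)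
    (h : ∫ f in (0 : ℝ)..1, ‖F f‖ ^ 2 ≤ K ^ 2) : ∫ f in (0 : ℝ)..1, ‖F f‖ ≤ K := by
  set I := ∫ f in (0 : ℝ)..1, ‖F f‖ with hI
  have h1 : 0 ≤ ∫ f in (0 : ℝ)..1, (‖F f‖ - I) ^ 2 :=
    intervalIntegral.integral_nonneg zero_le_one fun _ _ => sq_nonneg _
  have e : ∀ f, (‖F f‖ - I) ^ 2 = ‖F f‖ ^ 2 + (I ^ 2 - 2 * I * ‖F f‖) := fun f => by ring
  have i1 : IntervalIntegrable (fun f => ‖F f‖ ^ 2) volume 0 1 :=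
    (hF.norm.pow 2).intervalIntegrable _ _
  have i2 : IntervalIntegrable (fun f => 2 * I * ‖F f‖) volume 0 1 :=
    (continuous_const.mul hF.norm).intervalIntegrable _ _
  have i3 : IntervalIntegrable (fun f => I ^ 2 - 2 * I * ‖F f‖) volume 0 1 :=
    (continuous_const.sub (continuous_const.mul hF.norm)).intervalIntegrable _ _
  simp_rw [e] at h1
  rw [intervalIntegral.integral_add i1 i3, intervalIntegral.integral_sub intervalIntegrable_const i2,
    intervalIntegral.integral_const_mul, ← hI] at h1
  simp only [intervalIntegral.integral_const, sub_zero, one_smul] at h1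
  exact abs_le_of_sq_le_sq' (by nlinarith) hK |>.2

lemma integral_normSq_trigPoly_neg (A : Finset ℤ) (c : ℤ → ℂ) :
    ∫ f in (0 : ℝ)..1, ‖∑ m ∈ A, c m * Complex.exp (-(2 * Real.pi * f * m * Complex.I))‖ ^ 2 =
      ∑ m ∈ A, ‖c m‖ ^ 2 := by
  rw [← integral_normSq_trigPoly A neg_injective c]
  simp

/-! ### Windows and their energy -/

namespace IsWindow

variable {M : ℕ} {A : ℝ} {g : ℤ → ℝ}

lemma dtft_eq_sum (hg : IsWindow M A g) (f : ℝ) :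
    dtft g f = ∑ m ∈ Finset.Ioo (-(M : ℤ)) M,
      (g m : ℂ) * Complex.exp (-(2 * Real.pi * f * m * Complex.I)) := by
  refine tsum_eq_sum fun m hm => ?_
  rw [hg.support m (by rw [Finset.mem_Ioo, ← abs_lt] at hm; omega)]
  simp

lemma continuous_dtft (hg : IsWindow M A g) : Continuous (dtft g) := by
  rw [funext hg.dtft_eq_sum]
  fun_prop

lemma dtft_eq_re (hg : IsWindow M A g) (f : ℝ) : dtft g f = ((dtft g f).re : ℂ) := by
  refine (Complex.conj_eq_iff_re.1 ?_).symm
  rw [dtft, Complex.conj_tsum, ← (Equiv.neg ℤ).tsum_eq]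
  refine tsum_congr fun m => ?_
  have h2 : (starRingEnd ℂ) 2 = 2 := Complex.conj_ofReal 2
  simp [hg.even, ← Complex.exp_conj, h2]

lemma integral_dtft_re (hg : IsWindow M A g) (hM : 1 ≤ M) :
    ∫ f in (0 : ℝ)..1, (dtft g f).re = 1 := by
  rw [← Complex.ofReal_inj, ← intervalIntegral.integral_ofReal]
  simp_rw [← hg.dtft_eq_re, hg.dtft_eq_sum]
  rw [intervalIntegral.integral_finsetSum fun m _ =>
    Continuous.intervalIntegrable (by fun_prop) _ _]
  have e : ∀ m : ℤ, ∫ f in (0 : ℝ)..1, (g m : ℂ) *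
      Complex.exp (-(2 * Real.pi * f * m * Complex.I)) = if m = 0 then 1 else 0 := by
    intro m
    have := integral_cexp_two_pi_int (-m)
    simp only [Int.cast_neg, mul_neg, neg_mul, neg_eq_zero] at this
    rw [intervalIntegral.integral_const_mul, this]
    split_ifs with h
    · simp [h, hg.zero]
    · simp
  simp_rw [e]
  rw [Finset.sum_ite_eq' _ (0 : ℤ), if_pos (by simp; omega)]
  simp

lemma intervalIntegrable_dtft_re (hg : IsWindow M A g) :
    IntervalIntegrable (fun f => (dtft g f).re) volume 0 1 :=
  (Complex.continuous_re.comp hg.continuous_dtft).intervalIntegrable _ _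

lemma one_le (hg : IsWindow M A g) (hM : 1 ≤ M) : 1 ≤ A := by
  rw [← hg.integral_dtft_re hM]
  have := intervalIntegral.integral_mono_on_of_le_Ioo zero_le_one hg.intervalIntegrable_dtft_re
    (intervalIntegrable_const (c := A)) fun f hf => hg.dtft_le f (Set.Ioo_subset_Ico_self hf)
  simpa [hg.integral_dtft_re hM] using this

/-- By Parseval the sum is the integral of the squared transform `G²`. From `0 ≤ G ≤ A` follows `G²
≤ A G`, and `G` integrates to `g 0 = 1`. -/
lemma sum_sq_le (hg : IsWindow M A g) (hM : 1 ≤ M) :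
    ∑ m ∈ Finset.Ioo (-(M : ℤ)) M, g m ^ 2 ≤ A := by
  have h := integral_normSq_trigPoly_neg (Finset.Ioo (-(M : ℤ)) M) fun m => (g m : ℂ)
  simp_rw [← hg.dtft_eq_sum, Complex.norm_real, Real.norm_eq_abs, sq_abs] at h
  have hA : A = ∫ f in (0 : ℝ)..1, A * (dtft g f).re := by
    rw [intervalIntegral.integral_const_mul, hg.integral_dtft_re hM, mul_one]
  rw [← h, hA]
  refine intervalIntegral.integral_mono_on_of_le_Ioo zero_le_one
    ((hg.continuous_dtft.norm.pow 2).intervalIntegrable _ _)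
    (hg.intervalIntegrable_dtft_re.const_mul _) fun f hf => ?_
  have hf' := Set.Ioo_subset_Ico_self hf
  rw [hg.dtft_eq_re, Complex.norm_real, Real.norm_eq_abs, sq_abs, Complex.ofReal_re, pow_two]
  exact mul_le_mul_of_nonneg_right (hg.dtft_le f hf') (hg.dtft_nonneg f hf')

end IsWindow

lemma continuous_blackmanTukey {M : ℕ} (w : ℤ → ℝ) (x : Fin M → ℝ) :
    Continuous (blackmanTukey w x) := by
  unfold blackmanTukey
  fun_prop

/-- The type of the summation index depends on the lag, so the equality is transported through a
function of the natural number. -/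
lemma empiricalAcf_congr {M : ℕ} (x : Fin M → ℝ) {m n : ℤ} (h : m.natAbs = n.natAbs) :
    empiricalAcf x m = empiricalAcf x n := by
  let φ (k : ℕ) : ℝ := (1 / M) * ∑ n : Fin (M - k),
    x ⟨n + k, by have := n.isLt; omega⟩ * x ⟨n, by have := n.isLt; omega⟩
  exact congrArg φ h

lemma sq_le_samplingAcf {p : ℝ} (hp : 0 < p) (hp1 : p ≤ 1) (m : ℤ) : p ^ 2 ≤ samplingAcf p m := by
  unfold samplingAcf
  split_ifs
  · nlinarith
  · exact le_rfl

/-- A uniform error `δ` of the empirical autocorrelation gives an `L¹` error of at most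
`A δ / p²` of the spectral estimate. -/
lemma integral_norm_window_error_le {M : ℕ} {A : ℝ} {g : ℤ → ℝ} (hg : IsWindow M A g)
    (hM : 1 ≤ M) {p : ℝ} (hp : 0 < p) (hp1 : p ≤ 1) {ε : ℤ → ℝ} {δ : ℝ} (hδ : 0 ≤ δ)
    (hε : ∀ m ∈ Finset.Ioo (-(M : ℤ)) M, |ε m| ≤ δ) :
    ∫ f in (0 : ℝ)..1, ‖∑ m ∈ Finset.Ioo (-(M : ℤ)) M, ((correctedWindow p g m * ε m : ℝ) : ℂ) *
      Complex.exp (-(2 * Real.pi * f * m * Complex.I))‖ ≤ A / p ^ 2 * δ := by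
  have hA := hg.one_le hM
  refine intervalIntegral_norm_le_of_sq_le (by fun_prop) (by positivity) ?_
  rw [integral_normSq_trigPoly_neg]
  have h1 : ∀ m ∈ Finset.Ioo (-(M : ℤ)) M, ‖((correctedWindow p g m * ε m : ℝ) : ℂ)‖ ^ 2 ≤
      g m ^ 2 * (δ / p ^ 2) ^ 2 := by
    intro m hm
    have hu := sq_le_samplingAcf hp hp1 m
    have hu0 : 0 < p ^ 2 := by positivity
    rw [Complex.norm_real, Real.norm_eq_abs, ← sq_abs (g m), ← mul_pow, correctedWindow, abs_mul,
      abs_div, abs_of_pos (hu0.trans_le hu)]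
    have hle : |g m| / samplingAcf p m * |ε m| ≤ |g m| * (δ / p ^ 2) := by
      calc |g m| / samplingAcf p m * |ε m| ≤ |g m| / p ^ 2 * δ := by
            have := hε m hm
            gcongr
        _ = |g m| * (δ / p ^ 2) := by ring
    have h0 := hu0.trans_le hu
    gcongr
  refine (Finset.sum_le_sum h1).trans ?_
  rw [← Finset.sum_mul]
  calc (∑ m ∈ Finset.Ioo (-(M : ℤ)) M, g m ^ 2) * (δ / p ^ 2) ^ 2
      ≤ A ^ 2 * (δ / p ^ 2) ^ 2 := by
        gcongr
        nlinarith [hg.sum_sq_le hM]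
    _ = _ := by ring

/-- Subtracting the windowed sum from the Fourier series of `s` leaves exactly the terms `h[m] r[m]
e^{-i2πfm}`. -/
lemma norm_bias_le {M : ℕ} {s : ℝ → ℝ} {g : ℤ → ℝ} (hs : IsNormalizedPSD s) (f : ℝ) :
    ‖∑ m ∈ Finset.Ioo (-(M : ℤ)) M, ((g m * (1 - |(m : ℝ)| / M) : ℝ) : ℂ) * acf s m *
      Complex.exp (-(2 * Real.pi * f * m * Complex.I)) - s f‖ ≤ acfMoment M g s := by
  have hmem : ∀ m : ℤ, m ∈ Finset.Ioo (-(M : ℤ)) M ↔ |m| < M := fun m => by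
    rw [Finset.mem_Ioo, abs_lt]
  have h1 : HasSum (fun m : ℤ => if m ∈ Finset.Ioo (-(M : ℤ)) M then
      ((g m * (1 - |(m : ℝ)| / M) : ℝ) : ℂ) * acf s m *
        Complex.exp (-(2 * Real.pi * f * m * Complex.I)) else 0)
      (∑ m ∈ Finset.Ioo (-(M : ℤ)) M, ((g m * (1 - |(m : ℝ)| / M) : ℝ) : ℂ) * acf s m *
        Complex.exp (-(2 * Real.pi * f * m * Complex.I))) := by
    convert hasSum_sum_of_ne_finset_zero (L := .unconditional ℤ)
      (s := Finset.Ioo (-(M : ℤ)) M) ?_ using 1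
    · exact Finset.sum_congr rfl fun m hm => by rw [if_pos hm]
    · intro m hm
      rw [if_neg hm]
  have h2 := (hs.hasSum_acf f).sub h1
  have h3 : ∀ m : ℤ, acf s m * Complex.exp (-(2 * Real.pi * f * m * Complex.I)) -
      (if m ∈ Finset.Ioo (-(M : ℤ)) M then
        ((g m * (1 - |(m : ℝ)| / M) : ℝ) : ℂ) * acf s m *
        Complex.exp (-(2 * Real.pi * f * m * Complex.I)) else 0) =
      (momentWeight M g m : ℂ) * acf s m *
        Complex.exp (-(2 * Real.pi * f * m * Complex.I)) := by
    intro m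
    unfold momentWeight
    by_cases hm : |m| < (M : ℤ)
    · rw [if_pos ((hmem m).2 hm), if_pos hm]
      push_cast
      ring
    · rw [if_neg fun h => hm ((hmem m).1 h), if_neg hm]
      simp
  simp_rw [h3] at h2
  have hnorm : ∀ m : ℤ, ‖(momentWeight M g m : ℂ) * acf s m *
      Complex.exp (-(2 * Real.pi * f * m * Complex.I))‖ =
      |momentWeight M g m| * ‖acf s m‖ := by
    intro m
    have : -(2 * Real.pi * f * m * Complex.I) =
        ((-(2 * Real.pi * f * m) : ℝ) : ℂ) * Complex.I := by push_cast; ring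
    rw [norm_mul, norm_mul, Complex.norm_real, Real.norm_eq_abs, this,
      Complex.norm_exp_ofReal_mul_I, mul_one]
  -- The weights equal `1` outside a finite set, so summability is inherited from the
  -- autocorrelations.
  have hsum : Summable fun m : ℤ => |momentWeight M g m| * ‖acf s m‖ := by
    have hfin : Summable fun m : ℤ => (|momentWeight M g m| - 1) * ‖acf s m‖ := by
      refine summable_of_ne_finset_zero (s := Finset.Ioo (-(M : ℤ)) M) fun m hm => ?_
      have : ¬ |m| < (M : ℤ) := fun h => hm ((hmem m).2 h)
      simp [momentWeight, if_neg this]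
    refine (hs.summable_acf.add hfin).congr fun m => ?_
    ring
  rw [← norm_neg, neg_sub, ← h2.tsum_eq, acfMoment]
  simp_rw [← hnorm] at hsum ⊢
  exact norm_tsum_le_tsum_norm hsum

/-- The `L¹` error of the spectral estimate. -/
theorem integral_norm_blackmanTukey_sub_le {M : ℕ} {A : ℝ} {g : ℤ → ℝ} (hg : IsWindow M A g)
    (hM : 1 ≤ M) {p : ℝ} (hp : 0 < p) (hp1 : p ≤ 1) {s : ℝ → ℝ} (hs : IsNormalizedPSD s)
    {σ : ℝ≥0} (hreal : ∀ m, acf s m = ((acf s m).re : ℂ)) (heven : ∀ m, acf s (-m) = acf s m)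
    (x : Fin M → ℝ) {δ : ℝ} (hδ : 0 ≤ δ)
    (hx : ∀ m : ℕ, m < M → |empiricalAcf x m -
      (1 - m / M) * (samplingAcf p m * noisyAcf σ s m)| ≤ δ) :
    ∫ f in (0 : ℝ)..1, ‖blackmanTukey (correctedWindow p g) x f - ((s f + (σ : ℝ) ^ 2 : ℝ) : ℂ)‖ ≤
      A / p ^ 2 * δ + acfMoment M g s := by
  let ε (m : ℤ) : ℝ := empiricalAcf x m - (1 - |(m : ℝ)| / M) * (samplingAcf p m * noisyAcf σ s m)
  have hε : ∀ m ∈ Finset.Ioo (-(M : ℤ)) M, |ε m| ≤ δ := by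
    intro m hm
    rw [Finset.mem_Ioo] at hm
    have h := hx m.natAbs (by omega)
    have e : ε m = empiricalAcf x (m.natAbs : ℤ) - (1 - (m.natAbs : ℕ) / M) *
        (samplingAcf p (m.natAbs : ℤ) * noisyAcf σ s (m.natAbs : ℤ)) := by
      rcases Int.natAbs_eq m with hm' | hm'
      · simp only [ε]
        rw [← hm']
        congr 3
        rw [Nat.cast_natAbs, Int.cast_abs]
      · have h1 : empiricalAcf x m = empiricalAcf x (m.natAbs : ℤ) :=
          empiricalAcf_congr x (Int.natAbs_natCast _).symm
        have h2 : samplingAcf p m = samplingAcf p (m.natAbs : ℤ) := by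
          simp [samplingAcf]
        have h3 : noisyAcf σ s m = noisyAcf σ s (m.natAbs : ℤ) := by
          rw [noisyAcf, noisyAcf, ← heven (m.natAbs : ℤ), ← hm']
          simp
        have h4 : |(m : ℝ)| = (m.natAbs : ℕ) := by rw [Nat.cast_natAbs, Int.cast_abs]
        simp only [ε]
        rw [h1, h2, h3, h4]
    rw [e]; exact h
  let F (f : ℝ) : ℂ := ∑ m ∈ Finset.Ioo (-(M : ℤ)) M, ((correctedWindow p g m * ε m : ℝ) : ℂ) *
      Complex.exp (-(2 * Real.pi * f * m * Complex.I))
  let G (f : ℝ) : ℂ := ∑ m ∈ Finset.Ioo (-(M : ℤ)) M,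
    ((g m * (1 - |(m : ℝ)| / M) : ℝ) : ℂ) * acf s m *
      Complex.exp (-(2 * Real.pi * f * m * Complex.I))
  -- `F` is the random error and `G - s` the bias. The noise enters the mean at lag zero only, where
  -- `g 0 = 1` and the correction cancels `u`, so it contributes exactly the constant `σ²`.
  have hdec : ∀ f, blackmanTukey (correctedWindow p g) x f - ((s f + (σ : ℝ) ^ 2 : ℝ) : ℂ) =
      F f + (G f - s f) := by
    intro f
    have h0 : ∑ m ∈ Finset.Ioo (-(M : ℤ)) M, (if m = 0 then ((σ : ℝ) ^ 2 : ℂ) else 0) =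
        ((σ : ℝ) ^ 2 : ℂ) := by
      rw [Finset.sum_ite_eq' _ (0 : ℤ), if_pos (by simp; omega)]
    have h1 : blackmanTukey (correctedWindow p g) x f = F f + G f + ((σ : ℝ) ^ 2 : ℂ) := by
      rw [← h0]
      simp only [blackmanTukey, F, G, ← Finset.sum_add_distrib]
      refine Finset.sum_congr rfl fun m _ => ?_
      have hu : (samplingAcf p m : ℂ) ≠ 0 := by
        have := (show 0 < p ^ 2 by positivity).trans_le (sq_le_samplingAcf hp hp1 m)
        exact_mod_cast this.ne'
      rw [hreal m]
      split_ifs with hm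
      · subst hm
        simp only [ε, correctedWindow, noisyAcf, hg.zero, if_true]
        push_cast
        simp
        field_simp
        ring
      · simp only [ε, correctedWindow, noisyAcf, if_neg hm]
        push_cast
        field_simp
        ring
    rw [h1]
    push_cast
    ring
  have hFc : Continuous F := by fun_prop
  have hGc : Continuous G := by fun_prop
  have hsc := hs.continuous
  have hbc := continuous_blackmanTukey (correctedWindow p g) x
  calc ∫ f in (0 : ℝ)..1, ‖blackmanTukey (correctedWindow p g) x f -
        ((s f + (σ : ℝ) ^ 2 : ℝ) : ℂ)‖
      ≤ ∫ f in (0 : ℝ)..1, (‖F f‖ + acfMoment M g s) := by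
        refine intervalIntegral.integral_mono_on zero_le_one
          (Continuous.intervalIntegrable (by fun_prop) _ _)
          ((hFc.norm.add continuous_const).intervalIntegrable _ _) fun f _ => ?_
        rw [hdec]
        exact (norm_add_le _ _).trans (by gcongr; exact norm_bias_le hs f)
    _ = (∫ f in (0 : ℝ)..1, ‖F f‖) + acfMoment M g s := by
        rw [intervalIntegral.integral_add (hFc.norm.intervalIntegrable _ _)
          intervalIntegrable_const]
        simp
    _ ≤ _ := by
        gcongr
        exact integral_norm_window_error_le hg hM hp hp1 hδ hε

/-! The nearest neighbor graph has no false connections. -/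

section Deterministic

lemma psdDist_add_const (s s' : ℝ → ℝ) (c : ℝ) :
    psdDist s s' = (1 / 2) * ∫ f in (0 : ℝ)..1, |(s f + c) - (s' f + c)| := by
  simp [psdDist]

variable {M : ℕ} {w : ℤ → ℝ} {s s' : ℝ → ℝ} {c K : ℝ} {x y : Fin M → ℝ}

lemma obsDist_le (hs : Continuous s)
    (hx : ∫ f in (0 : ℝ)..1, ‖blackmanTukey w x f - ((s f + c : ℝ) : ℂ)‖ ≤ K)
    (hy : ∫ f in (0 : ℝ)..1, ‖blackmanTukey w y f - ((s f + c : ℝ) : ℂ)‖ ≤ K) :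
    obsDist w x y ≤ K := by
  have hbx := continuous_blackmanTukey w x
  have hby := continuous_blackmanTukey w y
  have h : ∫ f in (0 : ℝ)..1, ‖blackmanTukey w x f - blackmanTukey w y f‖ ≤
      ∫ f in (0 : ℝ)..1, (‖blackmanTukey w x f - ((s f + c : ℝ) : ℂ)‖ +
        ‖blackmanTukey w y f - ((s f + c : ℝ) : ℂ)‖) := by
    refine intervalIntegral.integral_mono_on zero_le_one
      (Continuous.intervalIntegrable (by fun_prop) _ _)
      (Continuous.intervalIntegrable (by fun_prop) _ _) fun f _ => ?_
    rw [norm_sub_rev (blackmanTukey w y f)]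
    exact norm_sub_le_norm_sub_add_norm_sub _ _ _
  rw [intervalIntegral.integral_add (Continuous.intervalIntegrable (by fun_prop) _ _)
    (Continuous.intervalIntegrable (by fun_prop) _ _)] at h
  unfold obsDist
  linarith

/-- Two errors of size `K`, halved, cost a single `K`; the common offset `c` drops out of the
difference of densities. -/
lemma psdDist_sub_le_obsDist (hs : Continuous s) (hs' : Continuous s')
    (hx : ∫ f in (0 : ℝ)..1, ‖blackmanTukey w x f - ((s f + c : ℝ) : ℂ)‖ ≤ K)
    (hy : ∫ f in (0 : ℝ)..1, ‖blackmanTukey w y f - ((s' f + c : ℝ) : ℂ)‖ ≤ K) :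
    psdDist s s' - K ≤ obsDist w x y := by
  have hbx := continuous_blackmanTukey w x
  have hby := continuous_blackmanTukey w y
  have h : ∫ f in (0 : ℝ)..1, |(s f + c) - (s' f + c)| ≤
      ∫ f in (0 : ℝ)..1, (‖blackmanTukey w x f - blackmanTukey w y f‖ +
        (‖blackmanTukey w x f - ((s f + c : ℝ) : ℂ)‖ +
        ‖blackmanTukey w y f - ((s' f + c : ℝ) : ℂ)‖)) := by
    refine intervalIntegral.integral_mono_on zero_le_one
      (Continuous.intervalIntegrable (by fun_prop) _ _)
      (Continuous.intervalIntegrable (by fun_prop) _ _) fun f _ => ?_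
    have e : |(s f + c) - (s' f + c)| = ‖(((s f + c : ℝ) : ℂ) - ((s' f + c : ℝ) : ℂ))‖ := by
      rw [← Complex.ofReal_sub, Complex.norm_real, Real.norm_eq_abs]
    have e2 : (((s f + c : ℝ) : ℂ) - ((s' f + c : ℝ) : ℂ)) =
        (blackmanTukey w x f - blackmanTukey w y f) +
        (-(blackmanTukey w x f - ((s f + c : ℝ) : ℂ)) +
          (blackmanTukey w y f - ((s' f + c : ℝ) : ℂ))) := by ring
    rw [e, e2]
    refine (norm_add_le _ _).trans (add_le_add_right ((norm_add_le _ _).trans ?_) _)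
    rw [norm_neg]
  rw [intervalIntegral.integral_add (Continuous.intervalIntegrable (by fun_prop) _ _)
    (Continuous.intervalIntegrable (by fun_prop) _ _),
    intervalIntegral.integral_add (Continuous.intervalIntegrable (by fun_prop) _ _)
    (Continuous.intervalIntegrable (by fun_prop) _ _)] at h
  rw [psdDist_add_const s s' c]
  unfold obsDist
  linarith

/-- If all distances within a class are smaller than all distances between classes, nearest
neighbors belong to the same class. -/
lemma noFalseConnections_of_lt {N L q : ℕ} {label : Fin N → Fin L} {D : Fin N → Fin N → ℝ}
    (hq : ∀ l, q + 1 ≤ (Finset.univ.filter fun i => label i = l).card)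
    (hD : ∀ i j v, label i = label j → label i ≠ label v → D i j < D i v)
    {T : Fin N → Finset (Fin N)} (hT : ∀ i, IsNearestNeighbors D q i (T i)) :
    NoFalseConnections (nnAdjacency D T) label := by
  have key : ∀ i, ∀ v ∈ T i, label i = label v := by
    intro i v hv
    by_contra hne
    -- Pigeonhole: the class without `i` has at least `q` nodes, whereas `T i` without the wrong
    -- neighbor `v` has `q - 1`. Some node of the class is thus left out although it is closer than
    -- `v`.
    obtain ⟨j, hj, hjT⟩ : ∃ j ∈ (Finset.univ.filter fun j => label j = label i).erase i,
        j ∉ (T i).erase v := by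
      by_contra! hsub
      have h1 := Finset.card_le_card (show (Finset.univ.filter fun j => label j = label i).erase i ⊆
        (T i).erase v from hsub)
      rw [Finset.card_erase_of_mem hv, (hT i).card, Finset.card_erase_of_mem (by simp)] at h1
      have h2 := hq (label i)
      have h3 : 0 < q := (hT i).card ▸ Finset.card_pos.2 ⟨v, hv⟩
      omega
    rw [Finset.mem_erase, Finset.mem_filter] at hj
    have hjv : j ≠ v := fun h => hne (h ▸ hj.2.2.symm)
    have hjT' : j ∉ T i := fun h => hjT (Finset.mem_erase.2 ⟨hjv, h⟩)
    exact absurd ((hT i).le v hv j hj.1 hjT') (not_le.2 (hD i j v hj.2.2.symm hne))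
  intro i j hij
  by_contra hne
  have h1 : i ∉ T j := fun h => hne (key j i h).symm
  have h2 : j ∉ T i := fun h => hne (key i j h)
  exact hij (by simp [nnAdjacency, weightMatrix, h1, h2])

end Deterministic

/-! ### Accuracy of the spectral estimate of one observation -/

namespace IsRealization

variable {p : ℝ} {σ : ℝ≥0} {s : ℝ → ℝ} {U X W : ℤ → Ω → ℝ}

/-- Covariances of a real process are real: this comes from the existence of a realization, not from
the density alone. -/
lemma acf_eq_re (h : IsRealization P p σ s U X W) (m : ℤ) : acf s m = ((acf s m).re : ℂ) := by
  have := h.signal.cov m 0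
  rw [sub_zero] at this
  rw [← this, Complex.ofReal_re]

lemma acf_neg (h : IsRealization P p σ s U X W) (m : ℤ) : acf s (-m) = acf s m := by
  have h1 := h.signal.cov m 0
  have h2 := h.signal.cov 0 m
  rw [sub_zero] at h1
  rw [zero_sub] at h2
  rw [← h1, ← h2]
  simp_rw [mul_comm]

/-- With probability at least `1 - 6 / M²`, the spectral estimate is accurate. -/
theorem measure_spectral_error_gt_le [IsProbabilityMeasure P] (h : IsRealization P p σ s U X W)
    (hs : IsNormalizedPSD s) {M : ℕ} (hM : 1 ≤ M) (hp : 0 < p) (hp1 : p ≤ 1)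
    {A : ℝ} {g : ℤ → ℝ} (hg : IsWindow M A g)
    {b : ℝ} (hb : ∀ f ∈ Set.Icc (0 : ℝ) 1, s f + (σ : ℝ) ^ 2 ≤ b)
    (hb1 : 1 ≤ b) (t : ℤ) {r : ℝ} (hr0 : 0 ≤ r)
    (hr : M * r ^ 2 = Real.log M) (hrb : r * b ≤ 1 / 6) :
    P.real {ω | A / p ^ 2 * ((5 * b + 7 * (1 + (σ : ℝ) ^ 2)) * r) + acfMoment M g s <
      ∫ f in (0 : ℝ)..1, ‖blackmanTukey (correctedWindow p g) (observation M U X W t ω) f -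
        ((s f + (σ : ℝ) ^ 2 : ℝ) : ℂ)‖} ≤ 6 / (M : ℝ) ^ 2 := by
  have hMpos : (0 : ℝ) < M := by exact_mod_cast hM
  -- Only nonnegative lags are needed, by symmetry; `M` events of probability at most `6 / M³` give
  -- `6 / M²`.
  let bad (m : ℕ) : Set Ω := {ω | M * ((5 * b + 7 * (1 + (σ : ℝ) ^ 2)) * r) ≤
        |∑ n : Fin (M - m),
          (U (t + (n : ℕ) + m) ω * (X (t + (n : ℕ) + m) ω + W (t + (n : ℕ) + m) ω)) *
          (U (t + (n : ℕ)) ω * (X (t + (n : ℕ)) ω + W (t + (n : ℕ)) ω)) -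
          (M - m : ℕ) * (samplingAcf p m * noisyAcf σ s m)|}
  have hbad : ∀ m, P.real (bad m) ≤ 6 / (M : ℝ) ^ 3 := fun m =>
    h.measure_abs_lag_ge_le hs hb hb1 t m (M - m) M hM (Nat.sub_le _ _) hr0 hr hrb
  refine (measureReal_mono (s₂ := ⋃ m ∈ Finset.range M, bad m) ?_ (measure_ne_top _ _)).trans
    ((measureReal_biUnion_finset_le _ _).trans ?_)
  · intro ω hω
    by_contra hcon
    simp only [Set.mem_iUnion, not_exists, Finset.mem_range] at hcon
    refine not_le.2 hω (integral_norm_blackmanTukey_sub_le hg hM hp hp1 hs h.acf_eq_re h.acf_neg _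
      (by positivity) fun m hm => ?_)
    have hlt := hcon m hm
    simp only [bad, Set.mem_ofPred_eq, not_le] at hlt
    have he : empiricalAcf (observation M U X W t ω) m = (1 / M) * ∑ n : Fin (M - m),
          (U (t + (n : ℕ) + m) ω * (X (t + (n : ℕ) + m) ω + W (t + (n : ℕ) + m) ω)) *
          (U (t + (n : ℕ)) ω * (X (t + (n : ℕ)) ω + W (t + (n : ℕ)) ω)) := by
      simp only [empiricalAcf, observation, Int.natAbs_natCast, Nat.cast_add, ← add_assoc]
    have hd : empiricalAcf (observation M U X W t ω) m -
        (1 - m / M) * (samplingAcf p m * noisyAcf σ s m) =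
        (1 / M) * (∑ n : Fin (M - m),
          (U (t + (n : ℕ) + m) ω * (X (t + (n : ℕ) + m) ω + W (t + (n : ℕ) + m) ω)) *
          (U (t + (n : ℕ)) ω * (X (t + (n : ℕ)) ω + W (t + (n : ℕ)) ω)) -
          (M - m : ℕ) * (samplingAcf p m * noisyAcf σ s m)) := by
      rw [he, Nat.cast_sub hm.le]
      field_simp
    rw [hd, abs_mul, abs_of_pos (by positivity), one_div, inv_mul_le_iff₀ hMpos]
    exact hlt.le
  · refine (Finset.sum_le_sum fun m _ => hbad m).trans (le_of_eq ?_)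
    rw [Finset.sum_const, Finset.card_range, nsmul_eq_mul]
    field_simp

end IsRealization

lemma acfMoment_nonneg (M : ℕ) (g : ℤ → ℝ) (s : ℝ → ℝ) : 0 ≤ acfMoment M g s :=
  tsum_nonneg fun _ => by positivity

end

/-! ### The theorem: union over observations and comparison of distances -/

theorem theorem1
    {Ω : Type*} [MeasurableSpace Ω] (P : Measure Ω) [IsProbabilityMeasure P]
    -- numbers of models, of observations, observation length, number of neighbors
    (L N M q : ℕ) (hM : 1 ≤ M)
    -- sampling probability, noise level, densities of the models
    (p : ℝ) (hp : 0 < p) (hp1 : p ≤ 1) (σ : ℝ≥0)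
    (s : Fin L → ℝ → ℝ) (hs : ∀ l, IsNormalizedPSD (s l))
    -- window
    (A : ℝ) (g : ℤ → ℝ) (hg : IsWindow M A g)
    -- the `i`-th observation starts at time `t i` of a realization of model `label i`; the
    -- realizations for different `i` may coincide, be independent, or depend on each other
    (label : Fin N → Fin L) (U X W : Fin N → ℤ → Ω → ℝ) (t : Fin N → ℤ)
    (hdata : ∀ i, IsRealization P p σ (s (label i)) (U i) (X i) (W i))
    -- `q ≤ min_l (n_l - 1)`
    (hq : ∀ l, q + 1 ≤ (Finset.univ.filter fun i => label i = l).card)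
    -- the clustering condition
    (hcluster : ∀ k l, k ≠ l →
      8 * √2 * A * (maxPSD s + (σ : ℝ) ^ 2 + √2 * (1 + p) * (1 + (σ : ℝ) ^ 2)) / p ^ 2
          * √(Real.log M / M) + 2 * maxAcfMoment M g s
        < psdDist (s k) (s l)) :
    1 - 6 * (N : ℝ) / (M : ℝ) ^ 2 ≤
      P.real {ω | ∀ T : Fin N → Finset (Fin N),
        let D : Fin N → Fin N → ℝ := fun i j =>
          obsDist (correctedWindow p g) (observation M (U i) (X i) (W i) (t i) ω)
            (observation M (U j) (X j) (W j) (t j) ω)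
        (∀ i, IsNearestNeighbors D q i (T i)) →
          NoFalseConnections (nnAdjacency D T) label} := by
  have hMpos : (0 : ℝ) < M := by exact_mod_cast hM
  -- With a single label present nothing can fail. Otherwise two different models exist, and the
  -- clustering condition for them also bounds `r`.
  by_cases hlab : ∀ i j, label i = label j
  · have huniv : {ω | ∀ T : Fin N → Finset (Fin N),
        let D : Fin N → Fin N → ℝ := fun i j =>
          obsDist (correctedWindow p g) (observation M (U i) (X i) (W i) (t i) ω)
            (observation M (U j) (X j) (W j) (t j) ω)
        (∀ i, IsNearestNeighbors D q i (T i)) →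
          NoFalseConnections (nnAdjacency D T) label} = Set.univ :=
      Set.eq_univ_of_forall fun ω T _ i j _ => hlab i j
    rw [huniv, probReal_univ]
    have : 0 ≤ 6 * (N : ℝ) / (M : ℝ) ^ 2 := by positivity
    linarith
  push Not at hlab
  obtain ⟨i₀, j₀, hij⟩ := hlab
  have hA := hg.one_le hM
  set b : ℝ := maxPSD s + (σ : ℝ) ^ 2 with hb
  set c : ℝ := 1 + (σ : ℝ) ^ 2 with hc
  set r : ℝ := √(Real.log M / M) with hrdef
  set μ : ℝ := maxAcfMoment M g s with hμ
  have hc1 : 1 ≤ c := by nlinarith [sq_nonneg (σ : ℝ)]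
  have hle : ∀ l, (⨆ f : Set.Ico (0 : ℝ) 1, s l f) ≤ maxPSD s := fun l =>
    le_ciSup (f := fun l => ⨆ f : Set.Ico (0 : ℝ) 1, s l f) (Set.finite_range _).bddAbove l
  have hsb : ∀ l, ∀ f ∈ Set.Icc (0 : ℝ) 1, s l f + (σ : ℝ) ^ 2 ≤ b := fun l f hf => by
    have := ((hs l).le_iSup hf).trans (hle l)
    linarith
  have hb1 : 1 ≤ b := by
    have := (hs (label i₀)).one_le_iSup.trans (hle _)
    nlinarith [sq_nonneg (σ : ℝ)]
  have hμle : ∀ l, acfMoment M g (s l) ≤ μ := fun l =>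
    le_ciSup (f := fun l => acfMoment M g (s l)) (Set.finite_range _).bddAbove l
  have hμ0 : 0 ≤ μ := (acfMoment_nonneg _ _ _).trans (hμle (label i₀))
  have hr0 : 0 ≤ r := Real.sqrt_nonneg _
  have hr : M * r ^ 2 = Real.log M := by
    rw [hrdef, Real.sq_sqrt (div_nonneg (Real.log_nonneg (by exact_mod_cast hM)) hMpos.le)]
    field_simp
  have hAp : 1 ≤ A / p ^ 2 := by
    rw [one_le_div (by positivity)]
    exact (pow_le_one₀ hp.le hp1).trans hA
  have hs2 : 7 / 5 ≤ √2 := Real.le_sqrt_of_sq_le (by norm_num)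
  have hs22 : √2 * √2 = 2 := Real.mul_self_sqrt (by norm_num)
  have hrw : ∀ z, 8 * √2 * A * z / p ^ 2 * r = A / p ^ 2 * (8 * √2 * z * r) := fun z => by ring
  have hgap : ∀ k l, k ≠ l →
      2 * (A / p ^ 2 * ((5 * b + 7 * c) * r) + μ) < psdDist (s k) (s l) := by
    intro k l hkl
    refine lt_of_le_of_lt ?_ (hcluster k l hkl)
    -- The right side is `8√2 b + 16(1 + p)c`; here `8√2 ≥ 56/5 ≥ 10` and `16 ≥ 14`.
    have hz : 2 * (5 * b + 7 * c) ≤ 8 * √2 * (b + √2 * (1 + p) * c) := by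
      have e : 8 * √2 * (b + √2 * (1 + p) * c) = 8 * (√2 * b) + 16 * ((1 + p) * c) := by
        linear_combination 8 * (1 + p) * c * hs22
      rw [e]
      nlinarith [mul_nonneg hp.le (show 0 ≤ c by linarith),
        mul_le_mul_of_nonneg_right hs2 (show 0 ≤ b by linarith)]
    have h := mul_le_mul_of_nonneg_left (mul_le_mul_of_nonneg_right hz hr0)
      (show 0 ≤ A / p ^ 2 by linarith)
    rw [hrw]
    linarith
  -- The model distance is at most `1`, so the clustering condition itself makes `r` small enough
  -- for the Chernoff bound.
  have hrb : r * b ≤ 1 / 6 := by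
    have h1 := (hcluster _ _ hij).trans_le ((hs _).psdDist_le_one (hs _))
    rw [hrw] at h1
    have hz : 0 ≤ 8 * √2 * (b + √2 * (1 + p) * c) * r := by positivity
    have h2 := le_mul_of_one_le_left hz hAp
    have h3 : 6 * b * r ≤ 8 * √2 * (b + √2 * (1 + p) * c) * r := by
      refine mul_le_mul_of_nonneg_right ?_ hr0
      have : 0 ≤ √2 * (1 + p) * c := by positivity
      nlinarith
    linarith
  let K : ℝ := A / p ^ 2 * ((5 * b + 7 * c) * r) + μ
  let bad (i : Fin N) : Set Ω := {ω | A / p ^ 2 * ((5 * b + 7 * c) * r) +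
      acfMoment M g (s (label i)) < ∫ f in (0 : ℝ)..1,
        ‖blackmanTukey (correctedWindow p g) (observation M (U i) (X i) (W i) (t i) ω) f -
          ((s (label i) f + (σ : ℝ) ^ 2 : ℝ) : ℂ)‖}
  have hbad : ∀ i, P.real (bad i) ≤ 6 / (M : ℝ) ^ 2 := fun i =>
    (hdata i).measure_spectral_error_gt_le (hs _) hM hp hp1 hg (hsb _) hb1 (t i) hr0 hr hrb
  have hunion : P.real (⋃ i, bad i) ≤ 6 * (N : ℝ) / (M : ℝ) ^ 2 := by
    refine (measureReal_iUnion_fintype_le _).trans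
      ((Finset.sum_le_sum fun i _ => hbad i).trans (le_of_eq ?_))
    rw [Finset.sum_const, Finset.card_univ, Fintype.card_fin, nsmul_eq_mul]
    ring
  -- Subadditivity suffices here, so measurability of the exceptional events is never needed.
  have hcompl : 1 ≤ P.real (⋃ i, bad i) + P.real (⋃ i, bad i)ᶜ := by
    have := measureReal_union_le (μ := P) (⋃ i, bad i) (⋃ i, bad i)ᶜ
    rwa [Set.union_compl_self, probReal_univ] at this
  refine le_trans (by linarith) (measureReal_mono (s₁ := (⋃ i, bad i)ᶜ) ?_)
  intro ω hω T D hT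
  have hgood : ∀ i, ∫ f in (0 : ℝ)..1,
      ‖blackmanTukey (correctedWindow p g) (observation M (U i) (X i) (W i) (t i) ω) f -
          ((s (label i) f + (σ : ℝ) ^ 2 : ℝ) : ℂ)‖ ≤ K := by
    intro i
    have : ω ∉ bad i := fun h => hω (Set.mem_iUnion.2 ⟨i, h⟩)
    exact (not_lt.1 this).trans (add_le_add_right (hμle _) _)
  refine noFalseConnections_of_lt hq (fun i j v hij hiv => ?_) hT
  have h1 : D i j ≤ K := obsDist_le (hs (label i)).continuous (hgood i) (by
    have := hgood j
    rwa [← hij] at this)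
  have h2 : psdDist (s (label i)) (s (label v)) - K ≤ D i v :=
    psdDist_sub_le_obsDist (hs _).continuous (hs _).continuous (hgood i) (hgood v)
  have h3 := hgap _ _ hiv
  simp only [K] at h1 h2
  linarith
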